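/- Let $R$ be a Dedekind domain or a field, let $\mathcal C$ be an $R$-linear abelian symmetric monoidal category (unit $\mathbf 1$, $R$-bilinear tensor product), and let $T:\mathcal C\to R\text{-}\mathrm{Mod}$ be a faithful exact $R$-linear symmetric tensor functor with values in the category of finitely generated $R$-modules; in particular $T(\mathbf 1)\cong R$. Let $\{V_i\mid i\in I\}$ be a family of objects of $\mathcal C$ such that: 1. the smallest full abelian unital tensor subcategory of $\mathcal C$ containing all $V_i$ (closed under finite direct sums, kernels, cokernels and tensor products, and containing $\mathbf 1$) is $\mathcal C$; 2. for every $i$ there is an object $W_i$ such that $T(V_i)$ and $T(W_i)$ are free $R$-modules, together with either a morphism $q_i:V_i\otimes W_i\to\mathbf 1$ such that $T(q_i):T(V_i)\otimes T(W_i)\to R$ is a perfect pairing, or a morphism $q_i:\mathbf 1\to V_i\otimes W_i$ such that $T(q_i)^\vee:T(V_i)^\vee\otimes T(W_i)^\vee\to R$ is a perfect pairing. Then $\mathcal C$ is rigid, in the following sense. If $R$ is a field, every object $V$ of $\mathcal C$ has a dual object $V^\vee$, that is, there are evaluation and coevaluation morphisms satisfying the triangle identities, so that naturally in $A,B$ $$\operatorname{Hom}(V\otimes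 A,B)\cong\operatorname{Hom}(A,V^\vee\otimes B),\qquad \operatorname{Hom}(V^\vee\otimes A,B)\cong\operatorname{Hom}(A,V\otimes B).$$ In general, every object $V$ for which $T(V)$ is projective has such a dual, and every object of $\mathcal C$ is a quotient of an object $V$ for which $T(V)$ is projective. Moreover, the Tannakian dual of $(\mathcal C,T)$ is not only a monoid but a group: for every commutative $R$-algebra $S$, every tensor endomorphism of the functor $S\otimes_R T$ is invertible. -/

import Mathlib

open CategoryTheory MonoidalCategory Limits TensorProduct

universe w u v₁ u₁

noncomputable section

namespace NoriRigidity

/-- `P` defines a full abelian unital tensor subcategory of `C`: it is closed under finite direct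
sums (in particular it contains the zero object), kernels, cokernels and tensor products, and it
contains the unit object. Closure under isomorphisms follows. -/
structure IsAbelianTensorSubcategory {C : Type u₁} [Category.{v₁} C] [Abelian C]
    [MonoidalCategory C] (P : ObjectProperty C) : Prop where
  finiteProducts : P.IsClosedUnderFiniteProducts
  kernels : P.IsClosedUnderKernels
  cokernels : P.IsClosedUnderCokernels
  monoidal : P.IsMonoidal

/-- The smallest full abelian tensor subcategory of `C` containing all `V i` is `C`. -/
def GeneratesAsAbelianTensor {C : Type u₁} [Category.{v₁} C] [Abelian C]
    [MonoidalCategory C] {I : Type w} (V : I → C) : Prop :=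
  ∀ P : ObjectProperty C, IsAbelianTensorSubcategory P → (∀ i, P (V i)) → ∀ X, P X

/-- `V'` is a dual of `V`: there are evaluation and coevaluation morphisms satisfying the triangle
identities (on both sides), and natural bijections `Hom(V ⊗ A, B) = Hom(A, V' ⊗ B)` and
`Hom(V' ⊗ A, B) = Hom(A, V ⊗ B)`. -/
structure IsDual {C : Type u₁} [Category.{v₁} C] [MonoidalCategory C] (V V' : C) : Prop where
  exactPairing : Nonempty (ExactPairing V V')
  exactPairing_symm : Nonempty (ExactPairing V' V)
  adj : Nonempty (tensorLeft V ⊣ tensorLeft V')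
  adj_symm : Nonempty (tensorLeft V' ⊣ tensorLeft V)

section

variable {R : Type u} [CommRing R] {C : Type u₁} [Category.{v₁} C] [MonoidalCategory C]
  (T : C ⥤ FGModuleCat.{u} R)

/-- The `R`-linear map underlying `T f`. -/
def mapLin {X Y : C} (f : X ⟶ Y) : T.obj X →ₗ[R] T.obj Y := (T.map f).hom.hom

variable [T.Monoidal]

/-- The structure map `T X ⊗ T Y → T (X ⊗ Y)` as a linear map. -/
def muLin (X Y : C) : T.obj X ⊗[R] T.obj Y →ₗ[R] T.obj (X ⊗ Y) :=
  (Functor.LaxMonoidal.μ T X Y).hom.hom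

/-- The structure map `T (X ⊗ Y) → T X ⊗ T Y`, inverse to `muLin`. -/
def deltaLin (X Y : C) : T.obj (X ⊗ Y) →ₗ[R] T.obj X ⊗[R] T.obj Y :=
  (Functor.OplaxMonoidal.δ T X Y).hom.hom

/-- The structure map `R → T 𝟙` as a linear map. -/
def epsLin : R →ₗ[R] T.obj (𝟙_ C) := (Functor.LaxMonoidal.ε T).hom.hom

/-- The structure map `T 𝟙 → R`, inverse to `epsLin`. -/
def etaLin : T.obj (𝟙_ C) →ₗ[R] R := (Functor.OplaxMonoidal.η T).hom.hom

/-- The bilinear form `T V × T W → R` given by `T q`, for `q : V ⊗ W ⟶ 𝟙`. -/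
def pairing {V W : C} (q : V ⊗ W ⟶ 𝟙_ C) : T.obj V →ₗ[R] T.obj W →ₗ[R] R :=
  TensorProduct.curry (etaLin T ∘ₗ mapLin T q ∘ₗ muLin T V W)

/-- The element of `T V ⊗ T W` given by `T q`, for `q : 𝟙 ⟶ V ⊗ W`. -/
def copairingElement {V W : C} (q : 𝟙_ C ⟶ V ⊗ W) : T.obj V ⊗[R] T.obj W :=
  deltaLin T V W (mapLin T q (epsLin T 1))

/-- The bilinear form `(T V)^∨ × (T W)^∨ → R` dual to `T q`, for `q : 𝟙 ⟶ V ⊗ W`: it sends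
`(φ, ψ)` to `(φ ⊗ ψ) (T q (1))`. -/
def dualPairing {V W : C} (q : 𝟙_ C ⟶ V ⊗ W) :
    Module.Dual R (T.obj V) →ₗ[R] Module.Dual R (T.obj W) →ₗ[R] R :=
  TensorProduct.curry
    (LinearMap.applyₗ (copairingElement T q) ∘ₗ TensorProduct.dualDistrib R (T.obj V) (T.obj W))

/-- The structure map `(S ⊗ T X) ⊗_S (S ⊗ T Y) → S ⊗ T (X ⊗ Y)` of the tensor functor
`S ⊗_R T`. -/
def muBaseChange (S : Type w) [CommRing S] [Algebra R S] (X Y : C) :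
    (S ⊗[R] T.obj X) ⊗[S] (S ⊗[R] T.obj Y) →ₗ[S] S ⊗[R] T.obj (X ⊗ Y) :=
  (muLin T X Y).baseChange S ∘ₗ
    (AlgebraTensorModule.distribBaseChange R S (T.obj X) (T.obj Y)).symm.toLinearMap

/-- The `S`-valued points of the Tannakian dual of `(C, T)`: the tensor endomorphisms of the
functor `S ⊗_R T` from `C` to `S`-modules. -/
@[ext]
structure TannakianDual (S : Type w) [CommRing S] [Algebra R S] where
  app (X : C) : S ⊗[R] T.obj X →ₗ[S] S ⊗[R] T.obj X
  naturality {X Y : C} (f : X ⟶ Y) :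
    app Y ∘ₗ (mapLin T f).baseChange S = (mapLin T f).baseChange S ∘ₗ app X
  tensor (X Y : C) :
    app (X ⊗ Y) ∘ₗ muBaseChange T S X Y =
      muBaseChange T S X Y ∘ₗ TensorProduct.map (app X) (app Y)
  unit : app (𝟙_ C) ∘ₗ (epsLin T).baseChange S = (epsLin T).baseChange S

/-- The monoid structure on the points of the Tannakian dual is composition. -/
instance (S : Type w) [CommRing S] [Algebra R S] : Monoid (TannakianDual T S) where
  one :=
    { app := fun _ => LinearMap.id
      naturality := fun _ => rfl
      tensor := fun _ _ => by rw [TensorProduct.map_id]; rfl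
      unit := rfl }
  mul a b :=
    { app := fun X => a.app X ∘ₗ b.app X
      naturality := fun f => by
        rw [LinearMap.comp_assoc, b.naturality, ← LinearMap.comp_assoc, a.naturality,
          LinearMap.comp_assoc]
      tensor := fun X Y => by
        rw [LinearMap.comp_assoc, b.tensor, ← LinearMap.comp_assoc, a.tensor,
          LinearMap.comp_assoc, TensorProduct.map_comp]
      unit := by rw [LinearMap.comp_assoc, b.unit, a.unit] }
  mul_assoc _ _ _ := rfl
  one_mul _ := rfl
  mul_one _ := rfl

end

end NoriRigidity

end

open NoriRigidity

/-! The proof shows that every object is a quotient of an object with a dual. The class of such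
quotients, `quotientsOfDualizable`, contains the `V i` and is an abelian tensor subcategory, so it
is all of the category. Closure under kernels rests on subobjects of dualizable objects being
dualizable (`IsDualizable.of_injective`). Duals of all objects with projective image come from the
companion for quotients (`IsDualizable.of_surjective`).

Both facts, and the dualizability of the `V i`, follow from one principle: an object with free image
`E` is dualizable as soon as it has a pairing into the unit that is nondegenerate on the left
(`isDualizable_of_pairing`), or a copairing whose contractions fill `E`
(`isDualizable_of_copairing`). The mechanism is Cramer's rule. If `E` has rank `n + 1`, the product
`E ⊗ ⋀ⁿ E → ⋀ⁿ⁺¹ E` is perfect with values in a module of rank one, so `⋀ⁿ E` twisted by an inverse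
of `⋀ⁿ⁺¹ E` is a dual of `E`, provided that the top power is invertible in the category. The
exterior powers are constructed inductively as images, without dividing by factorials. The given
pairing or copairing propagates to the top power, where an inverse is built by hand
(`isInvertible_of_pairing`, `isInvertible_of_isPoint`). In the case of a pairing its image is only a
nonzero ideal; it is invertible because `R` is Dedekind.

Since `T` is faithful and exact, all of this is carried out with linear maps, keeping track of which
ones come from morphisms (`Realizable`).

For the group statement, a tensor endomorphism fixes the coevaluation of a dualizable object. This
forces surjectivity there, hence on every quotient, and a surjective endomorphism of a finitely
generated module is bijective. -/

noncomputable section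

namespace NoriRigidity

set_option linter.unusedSectionVars false

/-! ### Faithful exact functors to finitely generated modules, on elements -/

section Exactness

variable {R : Type u} [CommRing R] {C : Type u₁} [Category.{v₁} C]
  (T : C ⥤ FGModuleCat.{u} R)

@[simp]
lemma mapLin_id (X : C) : mapLin T (𝟙 X) = LinearMap.id := by
  simp [mapLin]

lemma mapLin_comp {X Y Z : C} (f : X ⟶ Y) (g : Y ⟶ Z) :
    mapLin T (f ≫ g) = mapLin T g ∘ₗ mapLin T f := by
  simp [mapLin]

lemma mapLin_comp_apply {X Y Z : C} (f : X ⟶ Y) (g : Y ⟶ Z) (x : T.obj X) :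
    mapLin T (f ≫ g) x = mapLin T g (mapLin T f x) := by
  rw [mapLin_comp]; rfl

lemma mapLin_injective [T.Faithful] {X Y : C} {f g : X ⟶ Y} (h : mapLin T f = mapLin T g) :
    f = g :=
  T.map_injective (FGModuleCat.hom_ext h)

/-- The morphism `R ⟶ M` of finitely generated modules given by an element of `M`. -/
def elementHom {M : FGModuleCat.{u} R} (x : M) : FGModuleCat.of R R ⟶ M :=
  FGModuleCat.ofHom (W := M) (LinearMap.toSpanSingleton R M x)

lemma elementHom_apply_one {M : FGModuleCat.{u} R} (x : M) :
    (elementHom x).hom.hom (1 : R) = x :=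
  LinearMap.toSpanSingleton_apply_one R M x

lemma elementHom_comp {M N : FGModuleCat.{u} R} (x : M) (f : M ⟶ N) :
    elementHom x ≫ f = elementHom (f.hom.hom x) := by
  ext
  exact congrArg f.hom.hom (elementHom_apply_one x) |>.trans (elementHom_apply_one _).symm

/-- Elements are maps out of `R`, so a monomorphism can be tested on them; no kernel, which might
fail to be finitely generated, is needed. -/
lemma FGModuleCat_injective_of_mono {M N : FGModuleCat.{u} R} (f : M ⟶ N) [Mono f] :
    Function.Injective f.hom.hom := by
  intro x y h
  have : elementHom x = elementHom y := by
    rw [← cancel_mono f, elementHom_comp, elementHom_comp, h]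
  rw [← elementHom_apply_one x, this, elementHom_apply_one]

lemma FGModuleCat_surjective_of_epi {M N : FGModuleCat.{u} R} (f : M ⟶ N) [Epi f] :
    Function.Surjective f.hom.hom := by
  rw [← LinearMap.range_eq_top, ← Submodule.ker_mkQ (LinearMap.range f.hom.hom),
    LinearMap.ker_eq_top]
  have : f ≫ FGModuleCat.ofHom (V := N) (LinearMap.range f.hom.hom).mkQ =
      f ≫ FGModuleCat.ofHom (V := N) 0 := by
    ext x
    exact (Submodule.Quotient.mk_eq_zero _).2 ⟨x, rfl⟩
  exact congrArg (fun g => g.hom.hom) ((cancel_epi f).1 this)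

lemma mono_of_mapLin_injective [T.Faithful] {X Y : C} (f : X ⟶ Y)
    (h : Function.Injective (mapLin T f)) : Mono f where
  right_cancellation a b hab := by
    refine mapLin_injective T (LinearMap.ext fun x => h ?_)
    rw [← mapLin_comp_apply, ← mapLin_comp_apply, hab]

lemma epi_of_mapLin_surjective [T.Faithful] {X Y : C} (f : X ⟶ Y)
    (h : Function.Surjective (mapLin T f)) : Epi f where
  left_cancellation a b hab := by
    refine mapLin_injective T (LinearMap.ext fun y => ?_)
    obtain ⟨x, rfl⟩ := h y
    rw [← mapLin_comp_apply, ← mapLin_comp_apply, hab]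

lemma mapLin_surjective_of_epi [PreservesFiniteColimits T] {X Y : C} (f : X ⟶ Y) [Epi f] :
    Function.Surjective (mapLin T f) :=
  FGModuleCat_surjective_of_epi (T.map f)

lemma mapLin_injective_of_mono [PreservesFiniteLimits T] {X Y : C} (f : X ⟶ Y) [Mono f] :
    Function.Injective (mapLin T f) :=
  FGModuleCat_injective_of_mono (T.map f)

variable [Preadditive C] [T.Additive]

@[simp]
lemma mapLin_zero (X Y : C) : mapLin T (0 : X ⟶ Y) = 0 := by
  simp only [mapLin, Functor.map_zero]; rfl

lemma mapLin_add {X Y : C} (f g : X ⟶ Y) : mapLin T (f + g) = mapLin T f + mapLin T g := by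
  simp only [mapLin, Functor.map_add]; rfl

lemma mapLin_neg {X Y : C} (f : X ⟶ Y) : mapLin T (-f) = -mapLin T f := by
  simp only [mapLin, Functor.map_neg]; rfl

/-- An element killed by `T f` is a map out of `R` killed by `T f`, hence factors through the kernel
fork, which `T` preserves. -/
lemma range_mapLin_kernel_ι [PreservesFiniteLimits T] {X Y : C} (f : X ⟶ Y) [HasKernel f] :
    LinearMap.range (mapLin T (kernel.ι f)) = LinearMap.ker (mapLin T f) := by
  apply le_antisymm
  · rintro _ ⟨x, rfl⟩
    rw [LinearMap.mem_ker, ← mapLin_comp_apply, kernel.condition]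
    simp
  · intro x hx
    have hx' : elementHom x ≫ T.map f = 0 := by
      rw [elementHom_comp]
      ext
      refine (elementHom_apply_one _).trans ?_
      exact LinearMap.mem_ker.1 hx
    let l := KernelFork.mapIsLimit _ (kernelIsKernel f) T
    obtain ⟨g, hg⟩ := KernelFork.IsLimit.lift' l (elementHom x) hx'
    refine ⟨g.hom.hom (1 : R), ?_⟩
    have := congrArg (fun k => k.hom.hom (1 : R)) hg
    exact this.trans (elementHom_apply_one x)

lemma ker_mapLin_cokernel_π [PreservesFiniteColimits T] {X Y : C} (f : X ⟶ Y) [HasCokernel f] :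
    LinearMap.ker (mapLin T (cokernel.π f)) = LinearMap.range (mapLin T f) := by
  apply le_antisymm
  · intro y hy
    let q : T.obj Y ⟶ FGModuleCat.of R (T.obj Y ⧸ LinearMap.range (mapLin T f)) :=
      FGModuleCat.ofHom (V := T.obj Y) (LinearMap.range (mapLin T f)).mkQ
    have hq : T.map f ≫ q = 0 := by
      ext x
      exact (Submodule.Quotient.mk_eq_zero _).2 ⟨x, rfl⟩
    let l := CokernelCofork.mapIsColimit _ (cokernelIsCokernel f) T
    obtain ⟨g, hg⟩ := CokernelCofork.IsColimit.desc' l q hq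
    rw [← Submodule.Quotient.mk_eq_zero]
    have := congrArg (fun k => k.hom.hom y) hg
    refine this.symm.trans ?_
    change g.hom.hom (mapLin T (cokernel.π f) y) = 0
    rw [LinearMap.mem_ker.1 hy]
    exact map_zero g.hom.hom
  · rintro _ ⟨x, rfl⟩
    rw [LinearMap.mem_ker, ← mapLin_comp_apply, cokernel.condition]
    simp

end Exactness

/-! ### The tensor structure of `T` on elements -/

section Monoidal

variable {R : Type u} [CommRing R] {C : Type u₁} [Category.{v₁} C] [MonoidalCategory C]
  (T : C ⥤ FGModuleCat.{u} R) [T.Monoidal]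

@[simp]
lemma deltaLin_muLin (X Y : C) (t : T.obj X ⊗[R] T.obj Y) :
    deltaLin T X Y (muLin T X Y t) = t :=
  congrArg (fun f => f.hom.hom t) (Functor.Monoidal.μ_δ T X Y)

@[simp]
lemma muLin_deltaLin (X Y : C) (t : T.obj (X ⊗ Y)) :
    muLin T X Y (deltaLin T X Y t) = t :=
  congrArg (fun f => f.hom.hom t) (Functor.Monoidal.δ_μ T X Y)

@[simp]
lemma etaLin_epsLin (r : R) : etaLin T (epsLin T r) = r :=
  congrArg (fun f => f.hom.hom r) (Functor.Monoidal.ε_η T)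

@[simp]
lemma epsLin_etaLin (t : T.obj (𝟙_ C)) : epsLin T (etaLin T t) = t :=
  congrArg (fun f => f.hom.hom t) (Functor.Monoidal.η_ε T)

/-- The structure isomorphism `T (X ⊗ Y) ≃ T X ⊗ T Y`. -/
def deltaEquiv (X Y : C) : T.obj (X ⊗ Y) ≃ₗ[R] T.obj X ⊗[R] T.obj Y :=
  LinearEquiv.ofLinearMap (deltaLin T X Y) (muLin T X Y)
    (LinearMap.ext (deltaLin_muLin T X Y)) (LinearMap.ext (muLin_deltaLin T X Y))

/-- The structure isomorphism `T 𝟙 ≃ R`. -/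
def etaEquiv : T.obj (𝟙_ C) ≃ₗ[R] R :=
  LinearEquiv.ofLinearMap (etaLin T) (epsLin T)
    (LinearMap.ext (etaLin_epsLin T)) (LinearMap.ext (epsLin_etaLin T))

lemma mapLin_tensorHom_muLin {X Y X' Y' : C} (f : X ⟶ X') (g : Y ⟶ Y') (x : T.obj X)
    (y : T.obj Y) :
    mapLin T (f ⊗ₘ g) (muLin T X Y (x ⊗ₜ y)) = muLin T X' Y' (mapLin T f x ⊗ₜ mapLin T g y) :=
  (congrArg (fun h => h.hom.hom (x ⊗ₜ[R] y)) (Functor.LaxMonoidal.μ_natural T f g)).symm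

lemma mapLin_associator_muLin (X Y Z : C) (x : T.obj X) (y : T.obj Y) (z : T.obj Z) :
    mapLin T (α_ X Y Z).hom (muLin T (X ⊗ Y) Z (muLin T X Y (x ⊗ₜ y) ⊗ₜ z)) =
      muLin T X (Y ⊗ Z) (x ⊗ₜ muLin T Y Z (y ⊗ₜ z)) :=
  congrArg (fun h => h.hom.hom ((x ⊗ₜ[R] y) ⊗ₜ[R] z)) (Functor.LaxMonoidal.associativity T X Y Z)

lemma mapLin_leftUnitor_muLin (X : C) (r : R) (x : T.obj X) :
    mapLin T (λ_ X).hom (muLin T (𝟙_ C) X (epsLin T r ⊗ₜ x)) = r • x :=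
  (congrArg (fun h => h.hom.hom (r ⊗ₜ[R] x)) (Functor.LaxMonoidal.left_unitality T X)).symm

lemma mapLin_rightUnitor_muLin (X : C) (r : R) (x : T.obj X) :
    mapLin T (ρ_ X).hom (muLin T X (𝟙_ C) (x ⊗ₜ epsLin T r)) = r • x :=
  (congrArg (fun h => h.hom.hom (x ⊗ₜ[R] r)) (Functor.LaxMonoidal.right_unitality T X)).symm

end Monoidal

lemma mapLin_braiding_muLin {R : Type u} [CommRing R] {C : Type u₁} [Category.{v₁} C]
    [MonoidalCategory C] [BraidedCategory C] (T : C ⥤ FGModuleCat.{u} R) [T.Braided]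
    (X Y : C) (x : T.obj X) (y : T.obj Y) :
    mapLin T (β_ X Y).hom (muLin T X Y (x ⊗ₜ y)) = muLin T Y X (y ⊗ₜ x) :=
  congrArg (fun h => h.hom.hom (x ⊗ₜ[R] y)) (Functor.LaxBraided.braided (F := T) X Y)

/-! ### Realizations of modules and realizable linear maps -/

/-- A realization of the module `M`: an object of `C` together with an identification of its
image under `T` with `M`. -/
structure Realization {R : Type u} [CommRing R] {C : Type u₁} [Category.{v₁} C]
    (T : C ⥤ FGModuleCat.{u} R) (M : Type u) [AddCommGroup M] [Module R M] where
  obj : C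
  equiv : T.obj obj ≃ₗ[R] M

section Realization

variable {R : Type u} [CommRing R] {C : Type u₁} [Category.{v₁} C]
  {T : C ⥤ FGModuleCat.{u} R}
  {M N P Q : Type u} [AddCommGroup M] [Module R M] [AddCommGroup N] [Module R N]
  [AddCommGroup P] [Module R P] [AddCommGroup Q] [Module R Q]

/-- The linear map `φ` is induced by the morphism `f`. -/
def Lifts (A : Realization T M) (B : Realization T N) (f : A.obj ⟶ B.obj) (φ : M →ₗ[R] N) : Prop :=
  ∀ x, B.equiv (mapLin T f x) = φ (A.equiv x)

/-- The linear map `φ` is induced by a morphism. -/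
def Realizable (A : Realization T M) (B : Realization T N) (φ : M →ₗ[R] N) : Prop :=
  ∃ f, Lifts A B f φ

variable {A : Realization T M} {B : Realization T N} {D : Realization T P} {E : Realization T Q}

lemma Lifts.symm_apply {f : A.obj ⟶ B.obj} {φ : M →ₗ[R] N} (h : Lifts A B f φ) (m : M) :
    mapLin T f (A.equiv.symm m) = B.equiv.symm (φ m) := by
  rw [LinearEquiv.eq_symm_apply, h, LinearEquiv.apply_symm_apply]

lemma lifts_iff_symm {f : A.obj ⟶ B.obj} {φ : M →ₗ[R] N} :
    Lifts A B f φ ↔ ∀ m, B.equiv (mapLin T f (A.equiv.symm m)) = φ m :=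
  ⟨fun h m => by rw [h.symm_apply, LinearEquiv.apply_symm_apply],
    fun h x => by simpa using h (A.equiv x)⟩

lemma Lifts.injective {f : A.obj ⟶ B.obj} {φ : M →ₗ[R] N} (h : Lifts A B f φ)
    (hφ : Function.Injective φ) : Function.Injective (mapLin T f) := fun x y hxy =>
  A.equiv.injective (hφ (by rw [← h, ← h, hxy]))

lemma Lifts.surjective {f : A.obj ⟶ B.obj} {φ : M →ₗ[R] N} (h : Lifts A B f φ)
    (hφ : Function.Surjective φ) : Function.Surjective (mapLin T f) := fun y => by
  obtain ⟨m, hm⟩ := hφ (B.equiv y)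
  exact ⟨A.equiv.symm m, by rw [h.symm_apply, hm, LinearEquiv.symm_apply_apply]⟩

lemma Lifts.eq [T.Faithful] {f g : A.obj ⟶ B.obj} {φ : M →ₗ[R] N} (hf : Lifts A B f φ)
    (hg : Lifts A B g φ) : f = g :=
  mapLin_injective T (LinearMap.ext fun x => B.equiv.injective (by rw [hf, hg]))

lemma Lifts.comp {f : A.obj ⟶ B.obj} {g : B.obj ⟶ D.obj} {φ : M →ₗ[R] N} {ψ : N →ₗ[R] P}
    (hg : Lifts B D g ψ) (hf : Lifts A B f φ) : Lifts A D (f ≫ g) (ψ ∘ₗ φ) := fun x => by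
  rw [mapLin_comp_apply, hg, hf]; rfl

variable (A) in
lemma lifts_id : Lifts A A (𝟙 A.obj) LinearMap.id := fun x => by simp

variable (A) in
lemma Realizable.id : Realizable A A LinearMap.id := ⟨_, lifts_id A⟩

lemma Realizable.comp {φ : M →ₗ[R] N} {ψ : N →ₗ[R] P} (hψ : Realizable B D ψ)
    (hφ : Realizable A B φ) : Realizable A D (ψ ∘ₗ φ) :=
  let ⟨_, hf⟩ := hφ
  let ⟨_, hg⟩ := hψ
  ⟨_, hg.comp hf⟩

/-- The tautological realization of `T X`. -/
abbrev Realization.of (T : C ⥤ FGModuleCat.{u} R) (X : C) : Realization T (T.obj X) :=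
  ⟨X, LinearEquiv.refl R _⟩

variable (T) in
lemma realizable_mapLin {X Y : C} (f : X ⟶ Y) :
    Realizable (.of T X) (.of T Y) (mapLin T f) := ⟨f, fun _ => rfl⟩

/-- Transport of a realization along an isomorphism of modules. -/
abbrev Realization.congr (A : Realization T M) (e : M ≃ₗ[R] N) : Realization T N :=
  ⟨A.obj, A.equiv ≪≫ₗ e⟩

lemma Realizable.to_congr {φ : M →ₗ[R] N} (h : Realizable A B φ) (e : N ≃ₗ[R] P) :
    Realizable A (B.congr e) (e.toLinearMap ∘ₗ φ) := by
  obtain ⟨f, hf⟩ := h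
  exact ⟨f, fun x => congrArg e (hf x)⟩

lemma Realizable.from_congr {φ : M →ₗ[R] N} (h : Realizable A B φ) (e : M ≃ₗ[R] P) :
    Realizable (A.congr e) B (φ ∘ₗ e.symm.toLinearMap) := by
  obtain ⟨f, hf⟩ := h
  refine ⟨f, fun x => (hf x).trans ?_⟩
  exact congrArg φ (e.symm_apply_apply (A.equiv x)).symm

variable (A) in
lemma realizable_congr (e : M ≃ₗ[R] N) : Realizable A (A.congr e) e.toLinearMap :=
  (Realizable.id A).to_congr e

variable (A) in
lemma realizable_congr_symm (e : M ≃ₗ[R] N) : Realizable (A.congr e) A e.symm.toLinearMap :=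
  (Realizable.id A).from_congr e

section Preadditive

variable [Preadditive C] [T.Additive]

lemma Realizable.add {φ ψ : M →ₗ[R] N} (hφ : Realizable A B φ) (hψ : Realizable A B ψ) :
    Realizable A B (φ + ψ) := by
  obtain ⟨f, hf⟩ := hφ
  obtain ⟨g, hg⟩ := hψ
  exact ⟨f + g, fun x => by
    rw [mapLin_add, LinearMap.add_apply, map_add, hf, hg, LinearMap.add_apply]⟩

variable (A B) in
lemma Realizable.zero : Realizable A B 0 := ⟨0, fun x => by simp⟩

lemma Realizable.neg {φ : M →ₗ[R] N} (hφ : Realizable A B φ) : Realizable A B (-φ) := by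
  obtain ⟨f, hf⟩ := hφ
  exact ⟨-f, fun x => by rw [mapLin_neg, LinearMap.neg_apply, map_neg, hf, LinearMap.neg_apply]⟩

lemma Realizable.sub {φ ψ : M →ₗ[R] N} (hφ : Realizable A B φ) (hψ : Realizable A B ψ) :
    Realizable A B (φ - ψ) := by
  rw [sub_eq_add_neg]
  exact hφ.add hψ.neg

lemma Realizable.smul [Linear R C] [T.Linear R] {φ : M →ₗ[R] N} (r : R)
    (hφ : Realizable A B φ) : Realizable A B (r • φ) := by
  obtain ⟨f, hf⟩ := hφ
  refine ⟨r • f, fun x => ?_⟩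
  have : mapLin T (r • f) = r • mapLin T f := by
    simp only [mapLin, Functor.map_smul]; rfl
  rw [this, LinearMap.smul_apply, map_smul, hf, LinearMap.smul_apply]

end Preadditive

section Abelian

variable [Abelian C] [T.Additive] [T.Faithful] [PreservesFiniteLimits T]
  [PreservesFiniteColimits T]

/-- A linear map is realizable if its composition with a realizable injection is. -/
lemma Realizable.of_comp_injective {φ : M →ₗ[R] N} {d : N →ₗ[R] P} (hd : Realizable B D d)
    (hinj : Function.Injective d) (h : Realizable A D (d ∘ₗ φ)) : Realizable A B φ := by
  obtain ⟨k, hk⟩ := hd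
  obtain ⟨f, hf⟩ := h
  have := mono_of_mapLin_injective T k (hk.injective hinj)
  have hz : f ≫ cokernel.π k = 0 := by
    refine mapLin_injective T (LinearMap.ext fun x => ?_)
    have hx : mapLin T f x = mapLin T k (B.equiv.symm (φ (A.equiv x))) := by
      apply D.equiv.injective
      rw [hf, hk, LinearEquiv.apply_symm_apply]; rfl
    rw [mapLin_comp_apply, hx, ← mapLin_comp_apply, cokernel.condition]
    simp
  refine ⟨Abelian.monoLift k f hz, fun x => hinj ?_⟩
  rw [← hk, ← mapLin_comp_apply, Abelian.monoLift_comp, hf]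
  rfl

/-- A linear map is realizable if its composition with a realizable surjection is. -/
lemma Realizable.of_comp_surjective {φ : N →ₗ[R] P} {m : M →ₗ[R] N} (hm : Realizable A B m)
    (hsurj : Function.Surjective m) (h : Realizable A D (φ ∘ₗ m)) : Realizable B D φ := by
  obtain ⟨k, hk⟩ := hm
  obtain ⟨f, hf⟩ := h
  have := epi_of_mapLin_surjective T k (hk.surjective hsurj)
  have hz : kernel.ι k ≫ f = 0 := by
    refine mapLin_injective T (LinearMap.ext fun x => D.equiv.injective ?_)
    rw [mapLin_comp_apply, hf, LinearMap.comp_apply, ← hk, ← mapLin_comp_apply, kernel.condition]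
    simp
  refine ⟨Abelian.epiDesc k f hz, fun y => ?_⟩
  obtain ⟨x, rfl⟩ := hk.surjective hsurj y
  rw [← mapLin_comp_apply, Abelian.comp_epiDesc, hf, hk]
  rfl

/-- `T` is conservative: `e` composed with its inverse is the identity, so the inverse is realizable
after composing with a realizable injection. -/
lemma Realizable.symm {e : M ≃ₗ[R] N} (h : Realizable A B e.toLinearMap) :
    Realizable B A e.symm.toLinearMap :=
  h.of_comp_injective e.injective (by simpa using! Realizable.id B)

/-- The kernel of a realizable map is realizable. -/
lemma Realizable.exists_kernel {φ : M →ₗ[R] N} (h : Realizable A B φ) (d : P →ₗ[R] M)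
    (hinj : Function.Injective d) (hd : LinearMap.range d = LinearMap.ker φ) :
    ∃ D : Realization T P, Realizable D A d := by
  obtain ⟨f, hf⟩ := h
  have h₁ : Function.Injective (A.equiv.toLinearMap ∘ₗ mapLin T (kernel.ι f)) :=
    A.equiv.injective.comp (mapLin_injective_of_mono T _)
  have h₂ : LinearMap.range (A.equiv.toLinearMap ∘ₗ mapLin T (kernel.ι f)) = LinearMap.range d := by
    rw [LinearMap.range_comp, range_mapLin_kernel_ι, hd]
    ext m
    simp only [Submodule.mem_map, LinearMap.mem_ker]
    constructor
    · rintro ⟨x, hx, rfl⟩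
      change φ (A.equiv x) = 0
      rw [← hf, hx, map_zero]
    · intro hm
      refine ⟨A.equiv.symm m, B.equiv.injective ?_, by simp⟩
      rw [hf, LinearEquiv.apply_symm_apply, hm, map_zero]
  let e := LinearEquiv.ofInjective _ h₁ ≪≫ₗ LinearEquiv.ofEq _ _ h₂ ≪≫ₗ
    (LinearEquiv.ofInjective d hinj).symm
  refine ⟨⟨kernel f, e⟩, kernel.ι f, fun x => ?_⟩
  change _ = d ((LinearEquiv.ofInjective d hinj).symm _)
  rw [← LinearEquiv.ofInjective_apply d (h := hinj), LinearEquiv.apply_symm_apply]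
  rfl

/-- The cokernel of a realizable map is realizable. -/
lemma Realizable.exists_cokernel {φ : M →ₗ[R] N} (h : Realizable A B φ) (m : N →ₗ[R] P)
    (hsurj : Function.Surjective m) (hm : LinearMap.ker m = LinearMap.range φ) :
    ∃ D : Realization T P, Realizable B D m := by
  obtain ⟨f, hf⟩ := h
  have h₁ : Function.Surjective (mapLin T (cokernel.π f) ∘ₗ B.equiv.symm.toLinearMap) :=
    (mapLin_surjective_of_epi T _).comp B.equiv.symm.surjective
  have h₂ : LinearMap.ker (mapLin T (cokernel.π f) ∘ₗ B.equiv.symm.toLinearMap) =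
      LinearMap.ker m := by
    rw [LinearMap.ker_comp, ker_mapLin_cokernel_π, hm]
    ext n
    simp only [Submodule.mem_comap, LinearMap.mem_range]
    constructor
    · rintro ⟨x, hx⟩
      refine ⟨A.equiv x, ?_⟩
      rw [← hf, hx]
      exact B.equiv.apply_symm_apply n
    · rintro ⟨x, rfl⟩
      exact ⟨A.equiv.symm x, hf.symm_apply x⟩
  let e := (LinearMap.quotKerEquivOfSurjective _ h₁).symm ≪≫ₗ Submodule.quotEquivOfEq _ _ h₂ ≪≫ₗ
    LinearMap.quotKerEquivOfSurjective m hsurj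
  refine ⟨⟨cokernel f, e⟩, cokernel.π f, fun x => ?_⟩
  obtain ⟨n, rfl⟩ := B.equiv.symm.surjective x
  have : (LinearMap.quotKerEquivOfSurjective _ h₁).symm
      (mapLin T (cokernel.π f) (B.equiv.symm n)) = Submodule.Quotient.mk n := by
    rw [LinearEquiv.symm_apply_eq]; rfl
  change (LinearMap.quotKerEquivOfSurjective m hsurj) (Submodule.quotEquivOfEq _ _ h₂
    ((LinearMap.quotKerEquivOfSurjective _ h₁).symm _)) = _
  rw [this, LinearEquiv.apply_symm_apply]
  rfl

/-- The image of a realizable map is realizable. -/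
lemma Realizable.exists_image {m : M →ₗ[R] P} {d : P →ₗ[R] N} (h : Realizable A B (d ∘ₗ m))
    (hm : Function.Surjective m) (hd : Function.Injective d) :
    ∃ D : Realization T P, Realizable A D m ∧ Realizable D B d := by
  obtain ⟨K, hK⟩ := h.exists_kernel (LinearMap.ker (d ∘ₗ m)).subtype
    (Submodule.subtype_injective _) (Submodule.range_subtype _)
  obtain ⟨D, hD⟩ := hK.exists_cokernel m hm (by
    rw [Submodule.range_subtype, LinearMap.ker_comp_of_ker_eq_bot _ (LinearMap.ker_eq_bot.2 hd)])
  exact ⟨D, hD, .of_comp_surjective hD hm h⟩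

end Abelian

end Realization

/-! ### Tensor products of realizations, and points -/

section MonoidalRealization

variable {R : Type u} [CommRing R] {C : Type u₁} [Category.{v₁} C] [MonoidalCategory C]
  [BraidedCategory C] {T : C ⥤ FGModuleCat.{u} R} [T.Braided]
  {M N P Q : Type u} [AddCommGroup M] [Module R M] [AddCommGroup N] [Module R N]
  [AddCommGroup P] [Module R P] [AddCommGroup Q] [Module R Q]

/-- The tensor product of two realizations. -/
abbrev Realization.tensor (A : Realization T M) (B : Realization T N) : Realization T (M ⊗[R] N) :=
  ⟨A.obj ⊗ B.obj, deltaEquiv T A.obj B.obj ≪≫ₗ TensorProduct.congr A.equiv B.equiv⟩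

variable (T) in
/-- The realization of `R` by the unit object. -/
abbrev Realization.unit : Realization T R := ⟨𝟙_ C, etaEquiv T⟩

variable {A : Realization T M} {B : Realization T N} {D : Realization T P} {E : Realization T Q}

variable (A B) in
lemma tensor_equiv_symm_tmul (m : M) (n : N) :
    (A.tensor B).equiv.symm (m ⊗ₜ n) =
      muLin T A.obj B.obj (A.equiv.symm m ⊗ₜ B.equiv.symm n) := rfl

variable (A B) in
lemma tensor_equiv_muLin (x : T.obj A.obj) (y : T.obj B.obj) :
    (A.tensor B).equiv (muLin T A.obj B.obj (x ⊗ₜ y)) = A.equiv x ⊗ₜ B.equiv y := by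
  change TensorProduct.congr A.equiv B.equiv (deltaLin T A.obj B.obj _) = _
  rw [deltaLin_muLin, TensorProduct.congr_tmul]

variable (T) in
lemma unit_equiv_symm (r : R) : (Realization.unit T).equiv.symm r = epsLin T r := rfl

lemma lifts_of_tmul {f : A.obj ⊗ B.obj ⟶ D.obj} {φ : M ⊗[R] N →ₗ[R] P}
    (h : ∀ m n, D.equiv (mapLin T f (muLin T A.obj B.obj (A.equiv.symm m ⊗ₜ B.equiv.symm n))) =
      φ (m ⊗ₜ n)) : Lifts (A.tensor B) D f φ := by
  rw [lifts_iff_symm]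
  intro t
  induction t with
  | zero => simp
  | add x y hx hy => simp only [map_add, hx, hy]
  | tmul m n => rw [tensor_equiv_symm_tmul, h]

lemma Lifts.tensorHom {f : A.obj ⟶ B.obj} {g : D.obj ⟶ E.obj} {φ : M →ₗ[R] N} {ψ : P →ₗ[R] Q}
    (hf : Lifts A B f φ) (hg : Lifts D E g ψ) :
    Lifts (A.tensor D) (B.tensor E) (f ⊗ₘ g) (TensorProduct.map φ ψ) :=
  lifts_of_tmul fun m n => by
    rw [mapLin_tensorHom_muLin, tensor_equiv_muLin, hf.symm_apply, hg.symm_apply]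
    simp

lemma Lifts.whiskerLeft {g : D.obj ⟶ E.obj} {ψ : P →ₗ[R] Q} (hg : Lifts D E g ψ) :
    Lifts (A.tensor D) (A.tensor E) (A.obj ◁ g) (ψ.lTensor M) := by
  rw [← id_tensorHom]
  exact (lifts_id A).tensorHom hg

lemma Lifts.whiskerRight {f : A.obj ⟶ B.obj} {φ : M →ₗ[R] N} (hf : Lifts A B f φ) :
    Lifts (A.tensor D) (B.tensor D) (f ▷ D.obj) (φ.rTensor P) := by
  rw [← tensorHom_id]
  exact hf.tensorHom (lifts_id D)

lemma Lifts.inv {e : M ≃ₗ[R] N} {f : A.obj ≅ B.obj} (h : Lifts A B f.hom e.toLinearMap) :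
    Lifts B A f.inv e.symm.toLinearMap := fun y => by
  obtain ⟨x, rfl⟩ : ∃ x, mapLin T f.hom x = y :=
    ⟨mapLin T f.inv y, by rw [← mapLin_comp_apply, f.inv_hom_id, mapLin_id]; rfl⟩
  rw [h, ← mapLin_comp_apply, f.hom_inv_id, mapLin_id]
  simp

variable (A B D) in
lemma lifts_assoc : Lifts ((A.tensor B).tensor D) (A.tensor (B.tensor D))
    (α_ A.obj B.obj D.obj).hom (TensorProduct.assoc R M N P).toLinearMap := by
  refine lifts_of_tmul fun t p => ?_
  induction t with
  | zero => simp
  | add x y hx hy => simp only [map_add, hx, hy, TensorProduct.add_tmul]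
  | tmul m n =>
    rw [tensor_equiv_symm_tmul]
    change (A.tensor (B.tensor D)).equiv (mapLin T _ (muLin T (A.obj ⊗ B.obj) D.obj _)) = _
    rw [mapLin_associator_muLin]
    refine (tensor_equiv_muLin A (B.tensor D) _ _).trans ?_
    rw [tensor_equiv_muLin]
    simp

variable (A) in
lemma lifts_leftUnitor : Lifts ((Realization.unit T).tensor A) A (λ_ A.obj).hom
    (TensorProduct.lid R M).toLinearMap :=
  lifts_of_tmul fun r m => by
    rw [unit_equiv_symm]
    change A.equiv (mapLin T _ (muLin T (𝟙_ C) A.obj _)) = _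
    rw [mapLin_leftUnitor_muLin]
    simp

variable (A) in
lemma lifts_rightUnitor : Lifts (A.tensor (Realization.unit T)) A (ρ_ A.obj).hom
    (TensorProduct.rid R M).toLinearMap :=
  lifts_of_tmul fun m r => by
    rw [unit_equiv_symm]
    change A.equiv (mapLin T _ (muLin T A.obj (𝟙_ C) _)) = _
    rw [mapLin_rightUnitor_muLin]
    simp

variable (A B) in
lemma lifts_braiding : Lifts (A.tensor B) (B.tensor A) (β_ A.obj B.obj).hom
    (TensorProduct.comm R M N).toLinearMap :=
  lifts_of_tmul fun m n => by
    rw [mapLin_braiding_muLin, tensor_equiv_muLin]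
    simp

lemma Realizable.map {φ : M →ₗ[R] N} {ψ : P →ₗ[R] Q} (hφ : Realizable A B φ)
    (hψ : Realizable D E ψ) :
    Realizable (A.tensor D) (B.tensor E) (TensorProduct.map φ ψ) :=
  let ⟨_, hf⟩ := hφ
  let ⟨_, hg⟩ := hψ
  ⟨_, hf.tensorHom hg⟩

variable (A) in
lemma Realizable.lTensor {ψ : P →ₗ[R] Q} (hψ : Realizable D E ψ) :
    Realizable (A.tensor D) (A.tensor E) (ψ.lTensor M) := (Realizable.id A).map hψ

variable (D) in
lemma Realizable.rTensor {φ : M →ₗ[R] N} (hφ : Realizable A B φ) :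
    Realizable (A.tensor D) (B.tensor D) (φ.rTensor P) := hφ.map (Realizable.id D)

variable (A B D) in
lemma realizable_assoc : Realizable ((A.tensor B).tensor D) (A.tensor (B.tensor D))
    (TensorProduct.assoc R M N P).toLinearMap := ⟨_, lifts_assoc A B D⟩

variable (A B D) in
lemma realizable_assoc_symm : Realizable (A.tensor (B.tensor D)) ((A.tensor B).tensor D)
    (TensorProduct.assoc R M N P).symm.toLinearMap := ⟨_, (lifts_assoc A B D).inv⟩

variable (A B) in
lemma realizable_comm : Realizable (A.tensor B) (B.tensor A)
    (TensorProduct.comm R M N).toLinearMap := ⟨_, lifts_braiding A B⟩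

variable (A) in
lemma realizable_lid : Realizable ((Realization.unit T).tensor A) A
    (TensorProduct.lid R M).toLinearMap := ⟨_, lifts_leftUnitor A⟩

variable (A) in
lemma realizable_lid_symm : Realizable A ((Realization.unit T).tensor A)
    (TensorProduct.lid R M).symm.toLinearMap := ⟨_, (lifts_leftUnitor A).inv⟩

variable (A) in
lemma realizable_rid : Realizable (A.tensor (Realization.unit T)) A
    (TensorProduct.rid R M).toLinearMap := ⟨_, lifts_rightUnitor A⟩

variable (A) in
lemma realizable_rid_symm : Realizable A (A.tensor (Realization.unit T))
    (TensorProduct.rid R M).symm.toLinearMap := ⟨_, (lifts_rightUnitor A).inv⟩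

/-- An element of `M` is a realizable point if the map `R → M` it defines comes from a morphism
out of the unit object. -/
def IsPoint (A : Realization T M) (m : M) : Prop :=
  Realizable (Realization.unit T) A (LinearMap.toSpanSingleton R M m)

lemma IsPoint.map {φ : M →ₗ[R] N} (hφ : Realizable A B φ) {m : M} (hm : IsPoint A m) :
    IsPoint B (φ m) := by
  have := hφ.comp hm
  rwa [LinearMap.comp_toSpanSingleton] at this

lemma IsPoint.tmul {m : M} {n : N} (hm : IsPoint A m) (hn : IsPoint B n) :
    IsPoint (A.tensor B) (m ⊗ₜ n) := by
  have := (Realizable.map hm hn).comp (realizable_lid_symm (Realization.unit T))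
  unfold IsPoint
  convert this using 1
  ext
  simp

/-- Inserting a point on the left and contracting. -/
lemma IsPoint.contract {c : M ⊗[R] N} (hc : IsPoint (A.tensor B) c) {β : N ⊗[R] P →ₗ[R] Q}
    (hβ : Realizable (B.tensor D) E β) :
    Realizable D (A.tensor E)
      (β.lTensor M ∘ₗ (TensorProduct.assoc R M N P).toLinearMap ∘ₗ TensorProduct.mk R _ P c) := by
  have := ((hβ.lTensor A).comp (realizable_assoc A B D)).comp
    ((hc.rTensor D).comp (realizable_lid_symm D))
  convert this using 1
  ext p
  simp

section Preadditive

variable [Preadditive C] [T.Additive]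

lemma IsPoint.zero (A : Realization T M) : IsPoint A 0 := by
  unfold IsPoint
  convert Realizable.zero _ A
  ext; simp

lemma IsPoint.add {m m' : M} (hm : IsPoint A m) (hm' : IsPoint A m') : IsPoint A (m + m') := by
  have := Realizable.add hm hm'
  unfold IsPoint
  convert this using 1
  ext; simp

lemma IsPoint.smul [Linear R C] [T.Linear R] {m : M} (r : R) (hm : IsPoint A m) :
    IsPoint A (r • m) := by
  have := Realizable.smul r hm
  unfold IsPoint
  convert this using 1
  ext; simp

lemma isPoint_unit [Linear R C] [T.Linear R] (r : R) : IsPoint (Realization.unit T) r := by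
  have h : IsPoint (Realization.unit T) (1 : R) := by
    unfold IsPoint
    convert Realizable.id (Realization.unit T)
    ext; simp
  simpa using h.smul r

end Preadditive

end MonoidalRealization

/-! ### Direct sums of realizations -/

section Prod

variable {R : Type u} [CommRing R] {C : Type u₁} [Category.{v₁} C] [Preadditive C]
  [HasBinaryBiproducts C] {T : C ⥤ FGModuleCat.{u} R} [T.Additive]
  {M N P Q : Type u} [AddCommGroup M] [Module R M] [AddCommGroup N] [Module R N]
  [AddCommGroup P] [Module R P]

/-- The product of two realizations. -/
abbrev Realization.prod (A : Realization T M) (B : Realization T N) : Realization T (M × N) where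
  obj := A.obj ⊞ B.obj
  equiv := LinearEquiv.ofLinearMap
    ((A.equiv.toLinearMap ∘ₗ mapLin T biprod.fst).prod
      (B.equiv.toLinearMap ∘ₗ mapLin T biprod.snd))
    ((mapLin T biprod.inl ∘ₗ A.equiv.symm.toLinearMap).coprod
      (mapLin T biprod.inr ∘ₗ B.equiv.symm.toLinearMap))
    (by
      ext x <;> simp [← mapLin_comp_apply])
    (by
      ext x
      have h := congrArg (fun f => f x) (mapLin_add T (biprod.fst ≫ biprod.inl)
        ((biprod.snd : A.obj ⊞ B.obj ⟶ _) ≫ biprod.inr))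
      simp only [biprod.total, mapLin_id, mapLin_comp] at h
      simpa using! h.symm)

variable (A : Realization T M) (B : Realization T N) (D : Realization T P)

lemma realizable_fst : Realizable (A.prod B) A (LinearMap.fst R M N) := ⟨biprod.fst, fun _ => rfl⟩

lemma realizable_snd : Realizable (A.prod B) B (LinearMap.snd R M N) := ⟨biprod.snd, fun _ => rfl⟩

lemma realizable_inl : Realizable A (A.prod B) (LinearMap.inl R M N) :=
  ⟨biprod.inl, fun x => by
    change (A.equiv (mapLin T _ _), B.equiv (mapLin T _ _)) = _
    rw [← mapLin_comp_apply, ← mapLin_comp_apply, biprod.inl_fst, biprod.inl_snd]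
    simp⟩

lemma realizable_inr : Realizable B (A.prod B) (LinearMap.inr R M N) :=
  ⟨biprod.inr, fun x => by
    change (A.equiv (mapLin T _ _), B.equiv (mapLin T _ _)) = _
    rw [← mapLin_comp_apply, ← mapLin_comp_apply, biprod.inr_fst, biprod.inr_snd]
    simp⟩

variable {A B D}

lemma Realizable.coprod {φ : M →ₗ[R] P} {ψ : N →ₗ[R] P} (hφ : Realizable A D φ)
    (hψ : Realizable B D ψ) : Realizable (A.prod B) D (φ.coprod ψ) :=
  (hφ.comp (realizable_fst A B)).add (hψ.comp (realizable_snd A B))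

lemma Realizable.prod {φ : P →ₗ[R] M} {ψ : P →ₗ[R] N} (hφ : Realizable D A φ)
    (hψ : Realizable D B ψ) : Realizable D (A.prod B) (φ.prod ψ) := by
  have := ((realizable_inl A B).comp hφ).add ((realizable_inr A B).comp hψ)
  convert this using 1
  ext <;> simp

end Prod

/-! ### Constant realizations and dualizable realizations -/

section Duality

variable {R : Type u} [CommRing R] {C : Type u₁} [Category.{v₁} C] [Abelian C] [Linear R C]
  [MonoidalCategory C] [SymmetricCategory C] {T : C ⥤ FGModuleCat.{u} R} [T.Braided] [T.Additive]
  [T.Linear R] [T.Faithful] [PreservesFiniteLimits T] [PreservesFiniteColimits T]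
  {M N P Q : Type u} [AddCommGroup M] [Module R M] [AddCommGroup N] [Module R N]
  [AddCommGroup P] [Module R P] [AddCommGroup Q] [Module R Q]
  {A : Realization T M} {B : Realization T N} {D : Realization T P} {E : Realization T Q}

/-- A realization is constant if all elements are realizable points. -/
def IsConst (A : Realization T M) : Prop := ∀ m, IsPoint A m

variable (T) in
lemma isConst_unit : IsConst (Realization.unit T) := isPoint_unit

lemma IsConst.tensor (hA : IsConst A) (hB : IsConst B) : IsConst (A.tensor B) := fun t => by
  induction t with
  | zero => exact IsPoint.zero _
  | add x y hx hy => exact hx.add hy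
  | tmul m n => exact (hA m).tmul (hB n)

lemma IsConst.of_injective {d : M →ₗ[R] N} (hd : Realizable A B d) (hinj : Function.Injective d)
    (hB : IsConst B) : IsConst A := fun m =>
  hd.of_comp_injective hinj (by rw [LinearMap.comp_toSpanSingleton]; exact hB _)

lemma IsConst.of_surjective {d : M →ₗ[R] N} (hd : Realizable A B d)
    (hsurj : Function.Surjective d) (hA : IsConst A) : IsConst B := fun n => by
  obtain ⟨m, rfl⟩ := hsurj n
  exact (hA m).map hd

-- The realization is a finite sum of copies of the unit. The second clause, that maps out of it
-- need only be checked on points, is carried through the induction because it yields both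
-- `IsConst.realizable` and `exists_isConst`.
variable (T) in
lemma exists_isConst_fin_fun (k : ℕ) : ∃ A : Realization T (Fin k → R), IsConst A ∧
    ∀ {N : Type u} [AddCommGroup N] [Module R N] (B : Realization T N) (φ : (Fin k → R) →ₗ[R] N),
      (∀ x, IsPoint B (φ x)) → Realizable A B φ := by
  induction k with
  | zero =>
    obtain ⟨A, -⟩ := (Realizable.id (Realization.unit T)).exists_cokernel
      (0 : R →ₗ[R] (Fin 0 → R)) (fun x => ⟨0, Subsingleton.elim _ _⟩) (by simp)
    refine ⟨A, fun x => ?_, fun B φ _ => ?_⟩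
    · rw [Subsingleton.elim x 0]
      exact IsPoint.zero A
    · rw [Subsingleton.elim φ 0]
      exact Realizable.zero A B
  | succ k ih =>
    obtain ⟨A, hA, hA'⟩ := ih
    let e : (R × (Fin k → R)) ≃ₗ[R] (Fin (k + 1) → R) := Fin.consLinearEquiv R (fun _ => R)
    refine ⟨((Realization.unit T).prod A).congr e, fun x => ?_, fun B φ hφ => ?_⟩
    · obtain ⟨⟨r, y⟩, rfl⟩ := e.surjective x
      refine IsPoint.map (realizable_congr _ e) ?_
      have := ((isPoint_unit r).map (realizable_inl (Realization.unit T) A)).add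
        ((hA y).map (realizable_inr (Realization.unit T) A))
      simpa using this
    · have h₁ : Realizable (Realization.unit T) B (φ ∘ₗ e.toLinearMap ∘ₗ LinearMap.inl R R _) := by
        have := hφ (e (1, 0))
        unfold IsPoint at this
        convert this using 1
        ext
        simp
      have h₂ := hA' B (φ ∘ₗ e.toLinearMap ∘ₗ LinearMap.inr R R _) fun x => hφ _
      have := (h₁.coprod h₂).from_congr e
      convert this using 1
      refine LinearMap.ext fun x => ?_
      obtain ⟨⟨r, y⟩, rfl⟩ := e.surjective x
      simp only [LinearMap.comp_apply, LinearEquiv.coe_coe, LinearEquiv.symm_apply_apply,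
        LinearMap.coprod_apply, LinearMap.inl_apply, LinearMap.inr_apply]
      rw [← map_add, ← map_add]
      simp

/-- Cover `M` by a free module: both the cover and its composite with `φ` send elements to points,
so both are realizable, and `φ` descends. -/
lemma IsConst.realizable [Module.Finite R M] (hA : IsConst A) {φ : M →ₗ[R] N}
    (hφ : ∀ m, IsPoint B (φ m)) : Realizable A B φ := by
  obtain ⟨k, f, hf⟩ := Module.Finite.exists_fin' R M
  obtain ⟨F, -, hF⟩ := exists_isConst_fin_fun T k
  exact (hF A f fun x => hA _).of_comp_surjective hf (hF B _ fun x => hφ _)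

-- A finite projective module is the image of an idempotent endomorphism of `Rᵏ`, and every such
-- endomorphism is realizable on the sum of units.
variable (T M) in
lemma exists_isConst [Module.Finite R M] [Module.Projective R M] :
    ∃ A : Realization T M, IsConst A := by
  obtain ⟨k, f, hf⟩ := Module.Finite.exists_fin' R M
  obtain ⟨s, hs⟩ := Module.projective_lifting_property f LinearMap.id hf
  obtain ⟨F, hF, hF'⟩ := exists_isConst_fin_fun T k
  have hs' : Function.Injective s := fun x y h => by
    simpa using (LinearMap.congr_fun hs x).symm.trans
      ((congrArg f h).trans (LinearMap.congr_fun hs y))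
  obtain ⟨A, hA, -⟩ := (hF' F (s ∘ₗ f) fun x => hF _).exists_image hf hs'
  exact ⟨A, hF.of_surjective hA hf⟩

/-- The realizations `A` and `B` are dual to each other, with evaluation `b` and coevaluation
`∑ i, m i ⊗ₜ n i`. -/
structure IsDualPairing (A : Realization T M) (B : Realization T N) (b : M ⊗[R] N →ₗ[R] R)
    {ι : Type} [Fintype ι] (m : ι → M) (n : ι → N) : Prop where
  realizable : Realizable (A.tensor B) (Realization.unit T) b
  isPoint : IsPoint (A.tensor B) (∑ i, m i ⊗ₜ[R] n i)
  left (x : M) : ∑ i, b (x ⊗ₜ n i) • m i = x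
  right (y : N) : ∑ i, b (m i ⊗ₜ y) • n i = y

/-- A realization that admits a dual realization. -/
def IsDualizable (A : Realization T M) : Prop :=
  ∃ (N : Type u) (_ : AddCommGroup N) (_ : Module R N) (B : Realization T N)
    (b : M ⊗[R] N →ₗ[R] R) (ι : Type) (_ : Fintype ι) (m : ι → M) (n : ι → N),
    IsDualPairing A B b m n

/-- The first triangle identity is a finite dual basis: it splits `Rᶥ → M`. -/
lemma IsDualizable.projective (h : IsDualizable A) : Module.Projective R M := by
  obtain ⟨N, _, _, B, b, ι, _, m, n, h⟩ := h
  refine Module.Projective.of_split (M := ι → R)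
    (LinearMap.pi fun i => b ∘ₗ (TensorProduct.mk R M N).flip (n i))
    (Fintype.linearCombination R m) ?_
  ext x
  simpa [Fintype.linearCombination_apply] using h.left x

/-- Faithfulness reduces the categorical triangle identities to `left` and `right`, and the symmetry
exchanges the roles of the two objects. -/
lemma IsDualizable.exists_isDual (h : IsDualizable A) : ∃ X' : C, IsDual A.obj X' := by
  obtain ⟨N, _, _, B, b, ι, _, m, n, ⟨ev, hev⟩, ⟨co, hco⟩, hl, hr⟩ := h
  have hev' := hev.comp (lifts_braiding B A)
  let i : ExactPairing A.obj B.obj :=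
    { coevaluation' := co
      evaluation' := (β_ B.obj A.obj).hom ≫ ev
      coevaluation_evaluation' := by
        refine Lifts.eq (((hev'.whiskerRight (D := B)).comp (lifts_assoc B A B).inv).comp
          (hco.whiskerLeft (A := B))) ?_
        convert (lifts_leftUnitor B).inv.comp (lifts_rightUnitor B) using 1
        ext y
        simp only [TensorProduct.AlgebraTensorModule.curry_apply, TensorProduct.curry_apply,
          LinearMap.coe_restrictScalars, LinearMap.comp_apply, LinearMap.lTensor_tmul,
          LinearMap.toSpanSingleton_apply_one, TensorProduct.tmul_sum, map_sum,
          LinearEquiv.coe_coe, TensorProduct.assoc_symm_tmul, LinearMap.rTensor_tmul,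
          TensorProduct.comm_tmul, TensorProduct.rid_tmul, one_smul, TensorProduct.lid_symm_apply]
        nth_rw 2 [← hr y]
        rw [TensorProduct.tmul_sum]
        exact Finset.sum_congr rfl fun i _ => by
          rw [← TensorProduct.smul_tmul, smul_eq_mul, mul_one]
      evaluation_coevaluation' := by
        refine Lifts.eq (((hev'.whiskerLeft (A := A)).comp (lifts_assoc A B A)).comp
          (hco.whiskerRight (D := A))) ?_
        convert (lifts_rightUnitor A).inv.comp (lifts_leftUnitor A) using 1
        ext x
        simp only [TensorProduct.AlgebraTensorModule.curry_apply, TensorProduct.curry_apply,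
          LinearMap.coe_restrictScalars, LinearMap.comp_apply, LinearMap.lTensor_tmul,
          LinearMap.toSpanSingleton_apply_one, TensorProduct.sum_tmul, map_sum,
          LinearEquiv.coe_coe, TensorProduct.assoc_tmul, LinearMap.rTensor_tmul,
          TensorProduct.comm_tmul, TensorProduct.lid_tmul, one_smul, TensorProduct.rid_symm_apply]
        nth_rw 2 [← hl x]
        rw [TensorProduct.sum_tmul]
        exact Finset.sum_congr rfl fun i _ => by
          rw [TensorProduct.smul_tmul, smul_eq_mul, mul_one] }
  let j : ExactPairing B.obj A.obj := BraidedCategory.exactPairing_swap A.obj B.obj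
  exact ⟨B.obj, ⟨i⟩, ⟨j⟩, ⟨tensorLeftAdjunction B.obj A.obj⟩, ⟨tensorLeftAdjunction A.obj B.obj⟩⟩

/-- The transpose of a realizable pairing with respect to a realizable copairing. -/
lemma realizable_transpose {ι : Type} [Fintype ι] {m : ι → M} {n : ι → N}
    (hc : IsPoint (A.tensor B) (∑ i, m i ⊗ₜ[R] n i)) {β : M ⊗[R] P →ₗ[R] R}
    (hβ : Realizable (A.tensor D) (Realization.unit T) β) {φ : P →ₗ[R] N}
    (hφ : ∀ y, φ y = ∑ i, β (m i ⊗ₜ y) • n i) : Realizable D B φ := by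
  have := (realizable_rid B).comp ((hc.map (realizable_comm A B)).contract hβ)
  convert this using 1
  ext y
  simp [hφ]

/-- The dual of a retract is cut out of the dual of `A` by the transpose of the idempotent `i ∘ p`.
-/
lemma IsDualizable.of_retract (h : IsDualizable A) {i : P →ₗ[R] M} {p : M →ₗ[R] P}
    (hi : Realizable D A i) (hp : Realizable A D p) (hpi : ∀ x, p (i x) = x) :
    IsDualizable D := by
  obtain ⟨N, _, _, B, b, ι, _, m, n, h⟩ := h
  -- `t` is the transpose of `i ∘ p`, as `hb` confirms. It is idempotent, and its image is the
  -- desired dual.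
  let t : N →ₗ[R] N := ∑ j, (b ∘ₗ TensorProduct.mk R M N (i (p (m j)))).smulRight (n j)
  have ht (y : N) : t y = ∑ j, b (i (p (m j)) ⊗ₜ y) • n j := by simp [t]
  have hb (x : M) (y : N) : b (x ⊗ₜ t y) = b (i (p x) ⊗ₜ y) := by
    conv_rhs => rw [← h.left x]
    simp only [ht, TensorProduct.tmul_sum, TensorProduct.tmul_smul, map_sum, map_smul,
      TensorProduct.sum_tmul, ← TensorProduct.smul_tmul']
    exact Finset.sum_congr rfl fun j _ => by rw [smul_eq_mul, smul_eq_mul, mul_comm]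
  have htt (y : N) : t (t y) = t y := by
    rw [ht (t y)]
    simp only [hb, hpi]
    rw [ht y]
  have htr : Realizable B B t :=
    realizable_transpose h.isPoint (h.realizable.comp ((hi.comp hp).rTensor B)) fun y => by
      simp [ht]
  obtain ⟨B', hB₁, hB₂⟩ := Realizable.exists_image (m := t.rangeRestrict)
    (d := (LinearMap.range t).subtype) htr t.surjective_rangeRestrict
    (Submodule.subtype_injective _)
  refine ⟨LinearMap.range t, inferInstance, inferInstance, B',
    b ∘ₗ TensorProduct.map i (LinearMap.range t).subtype, ι, inferInstance, fun j => p (m j),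
    fun j => t.rangeRestrict (n j), h.realizable.comp (hi.map hB₂), ?_, fun x => ?_, fun y => ?_⟩
  · have := h.isPoint.map (hp.map hB₁)
    simpa using this
  · have := congrArg p (h.left (i x))
    rw [hpi] at this
    simpa [hb, hpi] using this
  · obtain ⟨_, y, rfl⟩ := y
    have := congrArg t (h.right (t y))
    rw [htt] at this
    ext
    simpa [hb, hpi] using this

lemma IsDualizable.of_tautological (h : IsDualizable A) : IsDualizable (Realization.of T A.obj) :=
  h.of_retract (i := A.equiv.toLinearMap) (p := A.equiv.symm.toLinearMap)
    ⟨𝟙 _, fun x => by simp⟩ ⟨𝟙 _, fun x => by simp⟩ fun x => by simp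

variable (A B D E) in
lemma realizable_tensorTensorTensorComm :
    Realizable ((A.tensor B).tensor (D.tensor E)) ((A.tensor D).tensor (B.tensor E))
      (TensorProduct.tensorTensorTensorComm R M N P Q).toLinearMap := by
  have := (realizable_assoc_symm A D (B.tensor E)).comp
    ((((realizable_assoc D B E).comp ((realizable_comm B D).rTensor E)).comp
      (realizable_assoc_symm B D E)).lTensor A |>.comp (realizable_assoc A B (D.tensor E)))
  convert this using 1
  ext
  simp

lemma IsDualizable.tensor (hA : IsDualizable A) (hD : IsDualizable D) :
    IsDualizable (A.tensor D) := by
  obtain ⟨N, _, _, B, b, ι, _, m, n, h⟩ := hA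
  obtain ⟨N', _, _, B', b', ι', _, m', n', h'⟩ := hD
  refine ⟨N ⊗[R] N', inferInstance, inferInstance, B.tensor B',
    (TensorProduct.lid R R).toLinearMap ∘ₗ TensorProduct.map b b' ∘ₗ
      (TensorProduct.tensorTensorTensorComm R M P N N').toLinearMap,
    ι × ι', inferInstance, fun i => m i.1 ⊗ₜ m' i.2, fun i => n i.1 ⊗ₜ n' i.2,
    (realizable_lid _).comp ((h.realizable.map h'.realizable).comp
      (realizable_tensorTensorTensorComm A D B B')), ?_, fun x => ?_, fun y => ?_⟩
  · have := (h.isPoint.tmul h'.isPoint).map (realizable_tensorTensorTensorComm A B D B')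
    rw [Fintype.sum_prod_type_right]
    simpa [TensorProduct.sum_tmul, TensorProduct.tmul_sum] using this
  · induction x with
    | zero => simp
    | add x y hx hy =>
      simp only [TensorProduct.add_tmul, map_add, add_smul, Finset.sum_add_distrib, hx, hy]
    | tmul x x' =>
      conv_rhs => rw [← h.left x, ← h'.left x']
      rw [Fintype.sum_prod_type_right]
      simp only [TensorProduct.sum_tmul, TensorProduct.tmul_sum, TensorProduct.smul_tmul_smul]
      simp
  · induction y with
    | zero => simp
    | add x y hx hy =>
      simp only [TensorProduct.tmul_add, map_add, add_smul, Finset.sum_add_distrib, hx, hy]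
    | tmul x x' =>
      conv_rhs => rw [← h.right x, ← h'.right x']
      rw [Fintype.sum_prod_type_right]
      simp only [TensorProduct.sum_tmul, TensorProduct.tmul_sum, TensorProduct.smul_tmul_smul]
      simp

lemma IsDualizable.prod (hA : IsDualizable A) (hD : IsDualizable D) :
    IsDualizable (A.prod D) := by
  obtain ⟨N, _, _, B, b, ι, _, m, n, h⟩ := hA
  obtain ⟨N', _, _, B', b', ι', _, m', n', h'⟩ := hD
  refine ⟨N × N', inferInstance, inferInstance, B.prod B',
    b ∘ₗ TensorProduct.map (LinearMap.fst R M P) (LinearMap.fst R N N') +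
      b' ∘ₗ TensorProduct.map (LinearMap.snd R M P) (LinearMap.snd R N N'),
    ι ⊕ ι', inferInstance, Sum.elim (fun i => (m i, 0)) (fun i => (0, m' i)),
    Sum.elim (fun i => (n i, 0)) (fun i => (0, n' i)),
    (h.realizable.comp ((realizable_fst A D).map (realizable_fst B B'))).add
      (h'.realizable.comp ((realizable_snd A D).map (realizable_snd B B'))),
    ?_, fun x => ?_, fun y => ?_⟩
  · have := (h.isPoint.map ((realizable_inl A D).map (realizable_inl B B'))).add
      (h'.isPoint.map ((realizable_inr A D).map (realizable_inr B B')))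
    simpa using this
  · ext
    · simpa [Prod.fst_sum] using h.left x.1
    · simpa [Prod.snd_sum] using h'.left x.2
  · ext
    · simpa [Prod.fst_sum] using h.right y.1
    · simpa [Prod.snd_sum] using h'.right y.2

/-- A finite projective module has a dual basis, and between constant realizations the evaluation
and the coevaluation are automatically realizable. -/
lemma IsConst.isDualizable [Module.Finite R M] [Module.Projective R M] (hA : IsConst A) :
    IsDualizable A := by
  obtain ⟨k, f, hf⟩ := Module.Finite.exists_fin' R M
  obtain ⟨s, hs⟩ := Module.projective_lifting_property f LinearMap.id hf
  obtain ⟨B, hB⟩ := exists_isConst T (Module.Dual R M)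
  have hx (x : M) : ∑ i, s x i • f (Pi.single i 1) = x := by
    refine Eq.trans ?_ (LinearMap.congr_fun hs x)
    rw [LinearMap.comp_apply]
    conv_rhs => rw [pi_eq_sum_univ' (s x)]
    simp
  refine ⟨Module.Dual R M, inferInstance, inferInstance, B,
    TensorProduct.lift (Module.Dual.eval R M), Fin k, inferInstance, fun i => f (Pi.single i 1),
    fun i => LinearMap.proj i ∘ₗ s, (hA.tensor hB).realizable fun t => isPoint_unit _,
    (hA.tensor hB) _, fun x => by simpa using hx x, fun y => ?_⟩
  ext x
  conv_rhs => rw [← hx x]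
  simp [mul_comm]

variable (T) in
lemma isDualizable_unit : IsDualizable (Realization.unit T) := (isConst_unit T).isDualizable

end Duality

/-! ### Exterior algebra: product, contraction, comultiplication -/

section Exterior

open ExteriorAlgebra CliffordAlgebra

variable {R : Type u} [CommRing R] {E : Type u} [AddCommGroup E] [Module R E]

lemma ι_mul_mem_exteriorPower {k : ℕ} (v : E) {w : ExteriorAlgebra R E} (hw : w ∈ ⋀[R]^k E) :
    ExteriorAlgebra.ι R v * w ∈ ⋀[R]^(k + 1) E := by
  rw [exteriorPower, pow_succ']
  exact Submodule.mul_mem_mul ⟨v, rfl⟩ hw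

lemma exteriorPower_succ_induction {k : ℕ} {p : ExteriorAlgebra R E → Prop}
    (hmul : ∀ v : E, ∀ w ∈ ⋀[R]^k E, p (ExteriorAlgebra.ι R v * w))
    (hadd : ∀ x y, p x → p y → p (x + y)) {w : ExteriorAlgebra R E} (hw : w ∈ ⋀[R]^(k + 1) E) :
    p w := by
  rw [exteriorPower, pow_succ'] at hw
  refine Submodule.mul_induction_on hw ?_ hadd
  rintro _ ⟨v, rfl⟩ w hw
  exact hmul v w hw

lemma contractLeft_eq_zero_of_mem {w : ExteriorAlgebra R E} (hw : w ∈ ⋀[R]^0 E)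
    (φ : Module.Dual R E) : contractLeft φ w = 0 := by
  rw [exteriorPower, pow_zero, Submodule.mem_one] at hw
  obtain ⟨r, rfl⟩ := hw
  exact contractLeft_algebraMap _ _ _

lemma contractLeft_mem_exteriorPower {k : ℕ} (φ : Module.Dual R E) {w : ExteriorAlgebra R E}
    (hw : w ∈ ⋀[R]^(k + 1) E) : contractLeft φ w ∈ ⋀[R]^k E := by
  induction k generalizing w with
  | zero =>
    refine exteriorPower_succ_induction (p := fun w => contractLeft φ w ∈ ⋀[R]^0 E)
      (fun v w hw => ?_) (fun x y hx hy => ?_) hw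
    · rw [contractLeft_ι_mul, contractLeft_eq_zero_of_mem hw, mul_zero, sub_zero]
      exact Submodule.smul_mem _ _ hw
    · rw [map_add]
      exact add_mem hx hy
  | succ k ih =>
    refine exteriorPower_succ_induction (p := fun w => contractLeft φ w ∈ ⋀[R]^(k + 1) E)
      (fun v w hw => ?_) (fun x y hx hy => ?_) hw
    · rw [contractLeft_ι_mul]
      exact sub_mem (Submodule.smul_mem _ _ hw) (ι_mul_mem_exteriorPower v (ih hw))
    · rw [map_add]
      exact add_mem hx hy

variable (R E) in
/-- The exterior product `E ⊗ ⋀ᵏ E → ⋀ᵏ⁺¹ E`. -/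
def wedge (k : ℕ) : E ⊗[R] ⋀[R]^k E →ₗ[R] ⋀[R]^(k + 1) E :=
  TensorProduct.lift <| LinearMap.mk₂ R
    (fun v w => ⟨ExteriorAlgebra.ι R v * w.1, ι_mul_mem_exteriorPower v w.2⟩)
    (fun v v' w => by ext; simp [add_mul]) (fun r v w => by ext; simp)
    (fun v w w' => by ext; simp [mul_add]) (fun r v w => by ext; simp)

@[simp]
lemma coe_wedge_tmul {k : ℕ} (v : E) (w : ⋀[R]^k E) :
    (wedge R E k (v ⊗ₜ w) : ExteriorAlgebra R E) = ExteriorAlgebra.ι R v * w := rfl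

lemma wedge_surjective (k : ℕ) : Function.Surjective (wedge R E k) := by
  rintro ⟨w, hw⟩
  suffices ∃ t, (wedge R E k t : ExteriorAlgebra R E) = w from
    this.imp fun t ht => Subtype.ext ht
  refine exteriorPower_succ_induction
    (p := fun w => ∃ t, (wedge R E k t : ExteriorAlgebra R E) = w)
    (fun v w hw => ⟨v ⊗ₜ ⟨w, hw⟩, rfl⟩) ?_ hw
  rintro _ _ ⟨s, rfl⟩ ⟨t, rfl⟩
  exact ⟨s + t, by simp⟩

/-- Contraction with a linear form, as a map `⋀ᵏ⁺¹ E → ⋀ᵏ E`. -/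
def contract (k : ℕ) (φ : Module.Dual R E) : ⋀[R]^(k + 1) E →ₗ[R] ⋀[R]^k E :=
  (contractLeft φ).restrict fun _ hw => contractLeft_mem_exteriorPower φ hw

@[simp]
lemma coe_contract {k : ℕ} (φ : Module.Dual R E) (w : ⋀[R]^(k + 1) E) :
    (contract k φ w : ExteriorAlgebra R E) = contractLeft φ (w : ExteriorAlgebra R E) := rfl

lemma contract_wedge_zero (φ : Module.Dual R E) (v : E) (w : ⋀[R]^0 E) :
    contract 0 φ (wedge R E 0 (v ⊗ₜ w)) = φ v • w := by
  ext
  rw [coe_contract, coe_wedge_tmul, contractLeft_ι_mul, contractLeft_eq_zero_of_mem w.2]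
  simp

lemma contract_wedge_succ {k : ℕ} (φ : Module.Dual R E) (v : E) (w : ⋀[R]^(k + 1) E) :
    contract (k + 1) φ (wedge R E (k + 1) (v ⊗ₜ w)) =
      φ v • w - wedge R E k (v ⊗ₜ contract k φ w) := by
  ext
  rw [coe_contract, coe_wedge_tmul, contractLeft_ι_mul]
  rfl

variable {n : ℕ} (e : Module.Basis (Fin n) R E)

/-- The comultiplication `⋀ᵏ⁺¹ E → E ⊗ ⋀ᵏ E`. -/
def comult (k : ℕ) : ⋀[R]^(k + 1) E →ₗ[R] E ⊗[R] ⋀[R]^k E :=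
  ∑ i, TensorProduct.mk R E _ (e i) ∘ₗ contract k (e.coord i)

lemma comult_apply (k : ℕ) (w : ⋀[R]^(k + 1) E) :
    comult e k w = ∑ i, e i ⊗ₜ contract k (e.coord i) w := by
  simp [comult]

lemma comult_wedge_zero : comult e 0 ∘ₗ wedge R E 0 = LinearMap.id := by
  refine TensorProduct.ext' fun v w => ?_
  simp only [LinearMap.comp_apply, comult_apply, contract_wedge_zero,
    LinearMap.id_apply]
  conv_rhs => rw [← e.sum_repr v, TensorProduct.sum_tmul]
  exact Finset.sum_congr rfl fun i _ => by
    rw [← TensorProduct.smul_tmul, Module.Basis.coord_apply]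

/-- Contraction is an antiderivation. The right side uses only degree `k`, so it is realizable
before `⋀ᵏ⁺²` has been constructed; this drives the induction. -/
lemma comult_wedge_succ (k : ℕ) : comult e (k + 1) ∘ₗ wedge R E (k + 1) =
    LinearMap.id - (wedge R E k).lTensor E ∘ₗ
      (TensorProduct.leftComm R E E (⋀[R]^k E)).toLinearMap ∘ₗ (comult e k).lTensor E := by
  refine TensorProduct.ext' fun v w => ?_
  simp only [LinearMap.comp_apply, comult_apply, contract_wedge_succ,
    LinearMap.id_apply, LinearMap.sub_apply, TensorProduct.tmul_sub, Finset.sum_sub_distrib,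
    LinearMap.lTensor_tmul, TensorProduct.tmul_sum, map_sum, LinearEquiv.coe_coe,
    TensorProduct.leftComm_tmul]
  congr 1
  conv_rhs => rw [← e.sum_repr v, TensorProduct.sum_tmul]
  exact Finset.sum_congr rfl fun i _ => by
    rw [← TensorProduct.smul_tmul, Module.Basis.coord_apply]

/-- The product of the basis vectors in a list of indices. -/
def listProd (l : List (Fin n)) : ExteriorAlgebra R E :=
  (l.map fun j => ExteriorAlgebra.ι R (e j)).prod

lemma ι_mul_listProd_mul_ι (v : E) (l : List (Fin n)) :
    ExteriorAlgebra.ι R v * listProd e l * ExteriorAlgebra.ι R v = 0 := by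
  induction l with
  | nil => simp [listProd]
  | cons b l ih =>
    have h : listProd e (b :: l) = ExteriorAlgebra.ι R (e b) * listProd e l := by simp [listProd]
    have hs := eq_neg_of_add_eq_zero_left (ExteriorAlgebra.ι_add_mul_swap (R := R) v (e b))
    rw [h, ← mul_assoc, hs, neg_mul, neg_mul, mul_assoc, mul_assoc, ← mul_assoc _ (listProd e l),
      ih, mul_zero, neg_zero]

lemma listProd_mul_ι {l : List (Fin n)} {j : Fin n} (hj : j ∈ l) :
    listProd e l * ExteriorAlgebra.ι R (e j) = 0 := by
  induction l with
  | nil => simp at hj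
  | cons b l ih =>
    have h : listProd e (b :: l) = ExteriorAlgebra.ι R (e b) * listProd e l := by simp [listProd]
    rw [h]
    rcases List.mem_cons.1 hj with rfl | hj
    · exact ι_mul_listProd_mul_ι e _ l
    · rw [mul_assoc, ih hj, mul_zero]

/-- The product of all basis vectors is a top form, and wedging it with any further vector repeats a
factor. -/
lemma listProd_finRange_mul {k : ℕ} {w : ExteriorAlgebra R E} (hw : w ∈ ⋀[R]^(k + 1) E) :
    listProd e (List.finRange n) * w = 0 := by
  refine exteriorPower_succ_induction (p := fun w => listProd e (List.finRange n) * w = 0)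
    (fun v w _ => ?_) (fun x y hx hy => ?_) hw
  · rw [← mul_assoc, ← e.sum_repr v, map_sum, Finset.mul_sum, Finset.sum_eq_zero, zero_mul]
    intro j _
    rw [map_smul, mul_smul_comm, listProd_mul_ι e (List.mem_finRange j), smul_zero]
  · rw [mul_add, hx, hy, add_zero]

lemma contractLeft_listProd_mul {w : ExteriorAlgebra R E} (j : Fin n)
    (hw : contractLeft (e.coord j) w = 0) {l : List (Fin n)} (hj : j ∉ l) :
    contractLeft (e.coord j) (listProd e l * w) = 0 := by
  induction l with
  | nil => simpa [listProd] using hw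
  | cons b l ih =>
    have h : listProd e (b :: l) = ExteriorAlgebra.ι R (e b) * listProd e l := by simp [listProd]
    rw [List.mem_cons, not_or] at hj
    rw [h, mul_assoc, contractLeft_ι_mul, ih hj.2]
    simp [Ne.symm hj.1]

/-- Contracting with the coordinate of the first factor strips that factor off: the other Leibniz
term vanishes, since neither the remaining factors nor `w` see this coordinate. -/
lemma eq_zero_of_listProd_mul {w : ExteriorAlgebra R E}
    (hw : ∀ j, contractLeft (e.coord j) w = 0) {l : List (Fin n)} (hl : l.Nodup)
    (h : listProd e l * w = 0) : w = 0 := by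
  induction l with
  | nil => simpa [listProd] using h
  | cons b l ih =>
    have h' : listProd e (b :: l) = ExteriorAlgebra.ι R (e b) * listProd e l := by simp [listProd]
    rw [List.nodup_cons] at hl
    refine ih hl.2 ?_
    have := congrArg (contractLeft (e.coord b)) h
    rw [h', mul_assoc, contractLeft_ι_mul, contractLeft_listProd_mul e b (hw b) hl.1] at this
    simpa using this

lemma eq_zero_of_contract {k : ℕ} {w : ⋀[R]^(k + 1) E}
    (h : ∀ j, contract k (e.coord j) w = 0) : w = 0 :=
  Subtype.ext <| eq_zero_of_listProd_mul e (fun j => congrArg Subtype.val (h j))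
    (List.nodup_finRange n) (listProd_finRange_mul e w.2)

/-- The components of the comultiplication along the basis are the contractions, which detect forms
of positive degree by `eq_zero_of_contract`. Injectivity makes `⋀ᵏ⁺¹ E` the image of `comult ∘
wedge`. -/
lemma comult_injective (k : ℕ) : Function.Injective (comult e k) := by
  rw [injective_iff_map_eq_zero]
  intro w hw
  refine eq_zero_of_contract e fun j => ?_
  have := congrArg (TensorProduct.lid R _ ∘ (e.coord j).rTensor _) hw
  simpa [comult_apply, Finsupp.single_apply] using this

/-- Iterated contraction with the coordinates in a list of indices. -/
def listContract (l : List (Fin n)) (w : ExteriorAlgebra R E) : ExteriorAlgebra R E :=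
  l.foldr (fun j y => contractLeft (e.coord j) y) w

lemma listContract_mem {k m : ℕ} {w : ExteriorAlgebra R E} (hw : w ∈ ⋀[R]^(k + m) E)
    {l : List (Fin n)} (hl : l.length = m) : listContract e l w ∈ ⋀[R]^k E := by
  induction l generalizing k m with
  | nil => subst hl; exact hw
  | cons b l ih =>
    subst hl
    refine contractLeft_mem_exteriorPower _ (ih (k := k + 1) (m := l.length) ?_ rfl)
    rwa [List.length_cons, ← add_assoc, add_right_comm] at hw

lemma ι_mul_listContract {w : ExteriorAlgebra R E} (j : Fin n)
    (hw : ExteriorAlgebra.ι R (e j) * w = 0) {l : List (Fin n)} (hj : j ∉ l) :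
    ExteriorAlgebra.ι R (e j) * listContract e l w = 0 := by
  induction l with
  | nil => exact hw
  | cons b l ih =>
    rw [List.mem_cons, not_or] at hj
    have := congrArg (contractLeft (e.coord b)) (ih hj.2)
    rw [contractLeft_ι_mul] at this
    simpa [hj.1, listContract] using this

/-- Mirror image of `eq_zero_of_listProd_mul`: multiplying back by `e b` undoes the contraction with
its coordinate. -/
lemma eq_zero_of_listContract {w : ExteriorAlgebra R E}
    (hw : ∀ j, ExteriorAlgebra.ι R (e j) * w = 0) {l : List (Fin n)} (hl : l.Nodup)
    (h : listContract e l w = 0) : w = 0 := by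
  induction l with
  | nil => exact h
  | cons b l ih =>
    rw [List.nodup_cons] at hl
    refine ih hl.2 ?_
    have := congrArg (contractLeft (e.coord b)) (ι_mul_listContract e b (hw b) hl.1)
    rw [contractLeft_ι_mul, show contractLeft (e.coord b) (listContract e l w) = 0 from h] at this
    simpa using this

/-- Contracting a form of degree `n` with all `n + 1` coordinates gives zero for degree reasons, and
the contractions can be peeled off. -/
lemma eq_zero_of_wedge {n : ℕ} (e : Module.Basis (Fin (n + 1)) R E) {u : ⋀[R]^n E}
    (h : ∀ j, wedge R E n (e j ⊗ₜ u) = 0) : u = 0 := by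
  refine Subtype.ext (eq_zero_of_listContract e (fun j => congrArg Subtype.val (h j))
    (List.nodup_finRange (n + 1)) ?_)
  rw [List.finRange_succ]
  refine contractLeft_eq_zero_of_mem (listContract_mem e (k := 0) (m := n) ?_ (by simp)) _
  rw [zero_add]
  exact u.2

lemma subsingleton_exteriorPower_succ [Nontrivial R] {n : ℕ} (e : Module.Basis (Fin n) R E) :
    Subsingleton (⋀[R]^(n + 1) E) := by
  have := Module.Free.of_basis e
  have := Module.Finite.of_basis e
  refine (Module.finBasisOfFinrankEq R (⋀[R]^(n + 1) E) (n := 0) ?_).equivFun.subsingleton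
  rw [exteriorPower.finrank_eq, Module.finrank_eq_card_basis e, Fintype.card_fin,
    Nat.choose_succ_self]

lemma exists_equiv_exteriorPower_top [Nontrivial R] {n : ℕ} (e : Module.Basis (Fin n) R E) :
    Nonempty (⋀[R]^n E ≃ₗ[R] R) := by
  have := Module.Free.of_basis e
  have := Module.Finite.of_basis e
  refine ⟨LinearEquiv.ofFinrankEq _ _ ?_⟩
  rw [exteriorPower.finrank_eq, Module.finrank_eq_card_basis e, Fintype.card_fin, Nat.choose_self,
    Module.finrank_self]

/-- Wedging with the contractions of a top form. -/
lemma wedge_contract_top [Nontrivial R] {n : ℕ} (e : Module.Basis (Fin (n + 1)) R E) (v : E)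
    (φ : Module.Dual R E) (ω : ⋀[R]^(n + 1) E) :
    wedge R E n (v ⊗ₜ contract n φ ω) = φ v • ω := by
  have := subsingleton_exteriorPower_succ e
  have h := contract_wedge_succ φ v ω
  rw [Subsingleton.elim (wedge R E (n + 1) (v ⊗ₜ ω)) 0, map_zero] at h
  exact (sub_eq_zero.1 h.symm).symm

lemma contract_eq_sum {k : ℕ} (φ : Module.Dual R E) (w : ⋀[R]^(k + 1) E) :
    contract k φ w = ∑ i, φ (e i) • contract k (e.coord i) w := by
  apply Subtype.ext
  rw [coe_contract]
  conv_lhs => rw [← e.sum_dual_apply_smul_coord φ, map_sum, LinearMap.sum_apply]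
  rw [AddSubmonoidClass.coe_finsetSum]
  exact Finset.sum_congr rfl fun i _ => by
    rw [map_smul, LinearMap.smul_apply, Submodule.coe_smul, coe_contract]

/-- A separating family of linear forms detects nonzero elements of `⋀ᵏ⁺¹ E` by contraction. -/
lemma exists_contract_ne_zero {n : ℕ} (e : Module.Basis (Fin n) R E) {W : Type*}
    (b : W → Module.Dual R E)
    (hb : ∀ v, (∀ w, b w v = 0) → v = 0) {k : ℕ} {t : ⋀[R]^(k + 1) E} (ht : t ≠ 0) :
    ∃ w, contract k (b w) t ≠ 0 := by
  by_contra! h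
  refine ht (eq_zero_of_contract e fun j => ?_)
  have := Module.Free.of_basis e
  let ε := Module.Free.chooseBasis R (⋀[R]^k E)
  refine ε.ext_elem fun s => ?_
  -- For a fixed index `s`, the `s`-th coordinates of the contractions of `t` are the components of
  -- one vector of `E`, which every `b w` kills.
  have hv := hb (∑ i, ε.repr (contract k (e.coord i) t) s • e i) fun w => by
    have := congrArg (fun x => ε.repr x s) (h w)
    rw [contract_eq_sum e] at this
    simpa [mul_comm] using this
  have := congrArg (fun x => e.repr x j) hv
  simpa [Finsupp.single_apply] using this

end Exterior

/-- A nonzero ideal of a Dedekind domain is a unit among fractional ideals, and unit submodules of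
the fraction field are invertible modules. -/
lemma module_invertible_ideal {R : Type u} [CommRing R] [IsDedekindDomain R] {I : Ideal R}
    (hI : I ≠ ⊥) : Module.Invertible R I := by
  let K := FractionRing R
  have hu : IsUnit (FractionalIdeal.coeSubmoduleHom (nonZeroDivisors R) K
      (I : FractionalIdeal (nonZeroDivisors R) K)) :=
    (isUnit_iff_ne_zero.2 (FractionalIdeal.coeIdeal_ne_zero.2 hI)).map
      (FractionalIdeal.coeSubmoduleHom (nonZeroDivisors R) K)
  obtain ⟨J, hJ⟩ := hu
  have hJ' : (J : Submodule R K) = Submodule.map (Algebra.linearMap R K) I := hJ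
  exact Module.Invertible.congr (LinearEquiv.ofEq _ _ hJ' ≪≫ₗ
    (Submodule.equivMapOfInjective (Algebra.linearMap R K) (IsFractionRing.injective R K) I).symm)

/-! ### Invertibility of realizations of rank one -/

section RankOne

variable {R : Type u} [CommRing R] {C : Type u₁} [Category.{v₁} C] [Abelian C] [Linear R C]
  [MonoidalCategory C] [SymmetricCategory C] {T : C ⥤ FGModuleCat.{u} R} [T.Braided] [T.Additive]
  [T.Linear R] [T.Faithful] [PreservesFiniteLimits T] [PreservesFiniteColimits T]
  {M N P : Type u} [AddCommGroup M] [Module R M] [AddCommGroup N] [Module R N]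
  [AddCommGroup P] [Module R P]

lemma realizable_leftComm (A : Realization T M) (B : Realization T N) (D : Realization T P) :
    Realizable (A.tensor (B.tensor D)) (B.tensor (A.tensor D))
      (TensorProduct.leftComm R M N P).toLinearMap := by
  have := (realizable_assoc B A D).comp (((realizable_comm A B).rTensor D).comp
    (realizable_assoc_symm A B D))
  convert this using 1
  ext
  simp

/-- A realization of `R` is invertible if it has a tensor inverse. -/
def IsInvertible (L : Realization T R) : Prop :=
  ∃ L' : Realization T R,
    Realizable (L.tensor L') (Realization.unit T) (TensorProduct.lid R R).toLinearMap

/-- A realization of `R` is invertible if its product with some `Z` has a unimodular point. -/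
lemma isInvertible_of_isPoint {L : Realization T R} {Z : Realization T M} {z : M}
    (hz : IsPoint (L.tensor Z) (1 ⊗ₜ z)) (χ : M →ₗ[R] R) (hχ : χ z = 1) : IsInvertible L := by
  have hz₁ := hz.map (realizable_congr (L.tensor Z) (TensorProduct.lid R M))
  obtain ⟨Q, hQ⟩ := Realizable.exists_cokernel hz₁ (Submodule.span R {z}).mkQ
    (Submodule.mkQ_surjective _) (by simp [LinearMap.range_toSpanSingleton])
  -- The line `R z` is visibly a subobject of `L ⊗ Z`; it is needed as a subobject of `Z`. The map
  -- `x ↦ [x] ⊗ z` has kernel `R z`, because `χ z = 1`, and it is a morphism out of `Z`: insert the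
  -- point `1 ⊗ z`, then move the factor `L` onto `x`.
  let φ : M →ₗ[R] (M ⧸ Submodule.span R {z}) ⊗[R] M :=
    (TensorProduct.mk R _ M).flip z ∘ₗ (Submodule.span R {z}).mkQ
  have hφ : Realizable Z (Q.tensor Z) φ := by
    have h₁ := (hQ.comp (realizable_congr (L.tensor Z) (TensorProduct.lid R M))).rTensor Z
    have h₂ := (realizable_assoc_symm L Z Z).comp (realizable_leftComm Z L Z)
    have h₃ := (Realizable.lTensor Z hz).comp (realizable_rid_symm Z)
    convert h₁.comp (h₂.comp h₃) using 1
    ext x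
    simp [φ]
  have hd : Function.Injective (LinearMap.toSpanSingleton R M z) := fun r s h => by
    simpa [hχ] using congrArg χ h
  obtain ⟨L', hL'⟩ := hφ.exists_kernel (LinearMap.toSpanSingleton R M z) hd (by
    rw [LinearMap.range_toSpanSingleton]
    ext x
    rw [LinearMap.mem_ker]
    constructor
    · intro hx
      simp [φ, (Submodule.Quotient.mk_eq_zero _).2 hx]
    · intro hx
      have := congrArg (TensorProduct.rid R _ ∘ χ.lTensor _) hx
      simpa [φ, hχ] using this)
  -- With `L' = R z` inside `Z`, the point `1 ⊗ z` lies in `L ⊗ L'` and generates it.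
  have hpt : IsPoint (L.tensor L') ((1 : R) ⊗ₜ[R] (1 : R)) := by
    refine (hL'.lTensor L).of_comp_injective
      (Module.Flat.lTensor_preserves_injective_linearMap _ hd) ?_
    rw [LinearMap.comp_toSpanSingleton]
    simpa using! hz
  refine ⟨L', Realizable.symm (e := (TensorProduct.lid R R).symm) ?_⟩
  unfold IsPoint at hpt
  convert hpt using 1
  ext
  simp

/-- A realization of `R` with a nonzero pairing with some `Z` is invertible. -/
lemma isInvertible_of_pairing [IsDedekindDomain R] {L : Realization T R} {Z : Realization T M}
    {φ : M →ₗ[R] R}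
    (hφ : Realizable (L.tensor Z) (Realization.unit T) (φ ∘ₗ (TensorProduct.lid R M).toLinearMap))
    (hne : φ ≠ 0) : IsInvertible L := by
  obtain ⟨z₀, hz₀⟩ := DFunLike.ne_iff.1 hne
  rw [LinearMap.zero_apply] at hz₀
  have hφ₁ : Realizable ((L.tensor Z).congr (TensorProduct.lid R M)) (Realization.unit T) φ := by
    convert hφ.from_congr (TensorProduct.lid R M) using 1
    ext; simp
  obtain ⟨K, hK⟩ := hφ₁.exists_kernel (LinearMap.ker φ).subtype (Submodule.subtype_injective _)
    (Submodule.range_subtype _)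
  -- The kernel of `φ` is a subobject of `L ⊗ Z`; it is needed as a subobject of `Z`. The map `k ⊗ z
  -- ↦ φ z • k` lands in `Z`, since `φ` can absorb the factor `L` that comes with `k`.
  let g : LinearMap.ker φ ⊗[R] M →ₗ[R] M :=
    (TensorProduct.rid R M).toLinearMap ∘ₗ TensorProduct.map (LinearMap.ker φ).subtype φ
  have hg : Realizable (K.tensor Z) Z g := by
    have h₁ := ((realizable_congr_symm (L.tensor Z) (TensorProduct.lid R M)).comp hK).rTensor Z
    have h₂ := (realizable_leftComm L Z Z).comp (realizable_assoc L Z Z)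
    have h₃ := (realizable_rid Z).comp (hφ.lTensor Z)
    convert h₃.comp (h₂.comp h₁) using 1
    ext
    simp [g]
  obtain ⟨Q, hQ⟩ := hg.exists_cokernel (LinearMap.range g).mkQ (Submodule.mkQ_surjective _)
    (by simp)
  -- The image of `g` is only `(range φ) • ker φ`. Multiplying by the nonzero scalar `φ z₀` before
  -- passing to the quotient recovers all of `ker φ`, as `R` is a domain.
  obtain ⟨K', hK'⟩ := (hQ.smul (φ z₀)).exists_kernel (LinearMap.ker φ).subtype
    (Submodule.subtype_injective _) (by
      rw [Submodule.range_subtype]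
      ext z
      rw [LinearMap.mem_ker, LinearMap.mem_ker, LinearMap.smul_apply, ← map_smul,
        Submodule.mkQ_apply, Submodule.Quotient.mk_eq_zero]
      constructor
      · intro hz
        exact ⟨⟨z, hz⟩ ⊗ₜ z₀, by simp [g]⟩
      · rintro ⟨t, ht⟩
        have hgt : φ ∘ₗ g = 0 := by
          ext
          simp [g]
        have hgt := LinearMap.congr_fun hgt t
        rw [LinearMap.comp_apply, ht, map_smul, smul_eq_mul] at hgt
        exact (mul_eq_zero.1 hgt).resolve_left hz₀)
  -- `L'` is `Z / ker φ`, with underlying module `I`. The pairing embeds `L ⊗ L'` in the unit, so `L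
  -- ⊗ L'` is constant; tensoring with a constant copy of `I^∨` turns `I` into `R`.
  let I : Ideal R := LinearMap.range φ
  let m : M →ₗ[R] I := φ.rangeRestrict
  have hm : Function.Surjective m := φ.surjective_rangeRestrict
  obtain ⟨L', hL'⟩ := hK'.exists_cokernel m hm (by
    rw [Submodule.range_subtype, LinearMap.ker_rangeRestrict])
  have hev : Realizable ((L.tensor L').congr (TensorProduct.lid R I)) (Realization.unit T)
      (Submodule.subtype I) := by
    refine Realizable.of_comp_surjective ((realizable_congr _ _).comp (hL'.lTensor L))
      ((TensorProduct.lid R I).surjective.comp (LinearMap.lTensor_surjective R hm)) ?_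
    convert hφ using 1
    ext
    simp [m]
  have hconst := (isConst_unit T).of_injective hev (Submodule.subtype_injective I)
  have hI : Module.Invertible R I := module_invertible_ideal fun h => hz₀ <| by
    have : φ z₀ ∈ I := ⟨z₀, rfl⟩
    rwa [h] at this
  obtain ⟨B, hB⟩ := exists_isConst T (Module.Dual R I)
  let e : I ⊗[R] Module.Dual R I ≃ₗ[R] R :=
    TensorProduct.comm R _ _ ≪≫ₗ Module.Invertible.linearEquiv R I
  refine ⟨(L'.tensor B).congr e, ?_⟩
  have h₁ := ((realizable_congr (L.tensor L') (TensorProduct.lid R I)).rTensor B).comp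
    ((realizable_assoc_symm L L' B).comp ((realizable_congr_symm (L'.tensor B) e).lTensor L))
  have h₂ : Realizable _ (Realization.unit T) e.toLinearMap :=
    (hconst.tensor hB).realizable fun _ => isPoint_unit _
  convert h₂.comp h₁ using 1
  refine TensorProduct.ext' fun r s => ?_
  obtain ⟨t, rfl⟩ := e.surjective s
  induction t with
  | zero => simp
  | add x y hx hy => simp only [TensorProduct.tmul_add, map_add, hx, hy]
  | tmul x y => simp [e, ← TensorProduct.smul_tmul']

end RankOne

/-! ### Exterior powers in the category, and Cramer's rule -/

section ExteriorRealization

open ExteriorAlgebra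

variable {R : Type u} [CommRing R] {C : Type u₁} [Category.{v₁} C] [Abelian C] [Linear R C]
  [MonoidalCategory C] [SymmetricCategory C] {T : C ⥤ FGModuleCat.{u} R} [T.Braided] [T.Additive]
  [T.Linear R] [T.Faithful] [PreservesFiniteLimits T] [PreservesFiniteColimits T]
  {E F : Type u} [AddCommGroup E] [Module R E] [AddCommGroup F] [Module R F]

/-- The exterior powers of a realization of a free module, with product and coproduct. -/
lemma exists_exteriorPower_realization (V : Realization T E) {n : ℕ}
    (e : Module.Basis (Fin n) R E) : ∃ X : ∀ k, Realization T (⋀[R]^k E),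
      IsConst (X 0) ∧ ∀ k, Realizable (V.tensor (X k)) (X (k + 1)) (wedge R E k) ∧
        Realizable (X (k + 1)) (V.tensor (X k)) (comult e k) := by
  -- Consecutive powers are kept together with both maps between them, since the next step needs
  -- both; successive pairs overlap.
  let S (k : ℕ) := {p : Realization T (⋀[R]^k E) × Realization T (⋀[R]^(k + 1) E) //
    Realizable (V.tensor p.1) p.2 (wedge R E k) ∧ Realizable p.2 (V.tensor p.1) (comult e k)}
  have step (k : ℕ) (X : Realization T (⋀[R]^k E))
      (hX : Realizable (V.tensor X) (V.tensor X) (comult e k ∘ₗ wedge R E k)) :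
      ∃ p : S k, p.1.1 = X := by
    obtain ⟨Y, hY⟩ := hX.exists_image (wedge_surjective k) (comult_injective e k)
    exact ⟨⟨(X, Y), hY⟩, rfl⟩
  obtain ⟨p₀, hp₀⟩ : ∃ p : S 0, IsConst p.1.1 := by
    obtain ⟨p, hp⟩ := step 0 ((Realization.unit T).congr (exteriorPower.zeroEquiv R E).symm) (by
      rw [comult_wedge_zero]
      exact Realizable.id _)
    exact ⟨p, hp ▸ (isConst_unit T).of_surjective (realizable_congr _ _)
      (exteriorPower.zeroEquiv R E).symm.surjective⟩
  have succ (k : ℕ) (p : S k) : ∃ q : S (k + 1), q.1.1 = p.1.2 := by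
    refine step (k + 1) p.1.2 ?_
    rw [comult_wedge_succ]
    exact (Realizable.id _).sub ((p.2.1.lTensor V).comp
      ((realizable_leftComm V V p.1.1).comp (p.2.2.lTensor V)))
  choose next hnext using succ
  let s : ∀ k, S k := fun k => Nat.rec p₀ next k
  have hs (k : ℕ) : (s (k + 1)).1.1 = (s k).1.2 := hnext k (s k)
  refine ⟨fun k => (s k).1.1, hp₀, fun k => ?_⟩
  beta_reduce
  rw [hs k]
  exact (s k).2

/-- A realization of a free module with invertible top exterior power is dualizable. -/
lemma isDualizable_of_isInvertible_top [Nontrivial R] (V : Realization T E) {n : ℕ}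
    (e : Module.Basis (Fin (n + 1)) R E) {U : Realization T (⋀[R]^n E)}
    {L : Realization T (⋀[R]^(n + 1) E)} (hw : Realizable (V.tensor U) L (wedge R E n))
    (hc : Realizable L (V.tensor U) (comult e n)) (θ : ⋀[R]^(n + 1) E ≃ₗ[R] R)
    (hL : IsInvertible (L.congr θ)) : IsDualizable V := by
  obtain ⟨L', hL'⟩ := hL
  have hθ (x : ⋀[R]^(n + 1) E) : x = θ x • θ.symm 1 := by
    rw [← map_smul, smul_eq_mul, mul_one, LinearEquiv.symm_apply_apply]
  -- The dual is `⋀ⁿ E ⊗ L'`, with the wedge product as evaluation. The coevaluation is the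
  -- comultiplication of the generator of the top power.
  refine ⟨⋀[R]^n E, inferInstance, inferInstance, (U.tensor L').congr (TensorProduct.rid R _),
    θ.toLinearMap ∘ₗ wedge R E n, Fin (n + 1), inferInstance, e,
    fun i => contract n (e.coord i) (θ.symm 1), ?_, ?_, fun x => ?_, fun y => ?_⟩
  · have h₁ := (realizable_assoc_symm V U L').comp
      ((realizable_congr_symm (U.tensor L') (TensorProduct.rid R _)).lTensor V)
    have h₂ := (hw.to_congr θ).rTensor L'
    convert hL'.comp (h₂.comp h₁) using 1
    refine TensorProduct.ext' fun v u => ?_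
    simp
  · have h₁ : IsPoint ((L.congr θ).tensor L') ((1 : R) ⊗ₜ[R] (1 : R)) := by
      have := hL'.symm
      unfold IsPoint
      convert this using 1
      ext
      simp
    have h₂ := (hc.from_congr θ).rTensor L'
    have h₃ := ((realizable_congr (U.tensor L') (TensorProduct.rid R _)).lTensor V).comp
      (realizable_assoc V U L')
    have := h₁.map (h₃.comp h₂)
    simpa [comult_apply, TensorProduct.sum_tmul] using this
  · simp only [LinearMap.comp_apply, wedge_contract_top e, LinearEquiv.coe_coe, map_smul,
      LinearEquiv.apply_symm_apply, smul_eq_mul, mul_one, Module.Basis.coord_apply]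
    exact e.sum_repr x
  -- The second triangle identity may be tested after wedging with each basis vector.
  · rw [← sub_eq_zero]
    refine eq_zero_of_wedge e fun j => ?_
    rw [TensorProduct.tmul_sub, TensorProduct.tmul_sum, map_sub, map_sum, sub_eq_zero]
    simp only [LinearMap.comp_apply, TensorProduct.tmul_smul, map_smul, wedge_contract_top e,
      LinearEquiv.coe_coe, Module.Basis.coord_apply, Module.Basis.repr_self]
    rw [Finset.sum_eq_single j]
    · rw [Finsupp.single_eq_same, one_smul, ← hθ]
    · intro i _ hij
      rw [Finsupp.single_eq_of_ne hij, zero_smul, smul_zero]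
    · simp

lemma Realization.finite (V : Realization T E) : Module.Finite R E := Module.Finite.equiv V.equiv

lemma isDualizable_of_subsingleton [Subsingleton E] (V : Realization T E) : IsDualizable V := by
  have := V.finite
  refine IsConst.isDualizable fun x => ?_
  rw [Subsingleton.elim x 0]
  exact IsPoint.zero V

/-- The comultiplication splits one vector off `⋀ᵏ⁺¹`; this vector is paired with `W` and the rest
with the previous `Z`. Nondegeneracy persists because contractions by the separating forms `b (· ⊗
w)` detect nonzero forms. -/
lemma exists_pairing_exteriorPower {V : Realization T E} {W : Realization T F}
    {b : E ⊗[R] F →ₗ[R] R} (hb : Realizable (V.tensor W) (Realization.unit T) b)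
    (hsep : ∀ v, (∀ w, b (v ⊗ₜ w) = 0) → v = 0) {n : ℕ} (e : Module.Basis (Fin n) R E)
    {X : ∀ k, Realization T (⋀[R]^k E)} (hX₀ : IsConst (X 0))
    (hX : ∀ k, Realizable (X (k + 1)) (V.tensor (X k)) (comult e k)) (k : ℕ) :
    ∃ (M : Type u) (_ : AddCommGroup M) (_ : Module R M) (Z : Realization T M)
      (ψ : ⋀[R]^k E ⊗[R] M →ₗ[R] R), Realizable ((X k).tensor Z) (Realization.unit T) ψ ∧
        ∀ t ≠ 0, ∃ z, ψ (t ⊗ₜ z) ≠ 0 := by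
  induction k with
  | zero =>
    have := V.finite
    refine ⟨R, inferInstance, inferInstance, Realization.unit T,
      (exteriorPower.zeroEquiv R E).toLinearMap ∘ₗ (TensorProduct.rid R _).toLinearMap,
      (hX₀.tensor (isConst_unit T)).realizable fun _ => isPoint_unit _, fun t ht => ⟨1, ?_⟩⟩
    simpa using ht
  | succ k ih =>
    obtain ⟨M, _, _, Z, ψ, hψ, hψ'⟩ := ih
    have h₁ := (hX k).rTensor (W.tensor Z)
    have h₂ := (hb.map hψ).comp (realizable_tensorTensorTensorComm V (X k) W Z)
    refine ⟨F ⊗[R] M, inferInstance, inferInstance, W.tensor Z, _,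
      (realizable_lid _).comp (h₂.comp h₁), fun t ht => ?_⟩
    obtain ⟨w, hw⟩ := exists_contract_ne_zero e
      (fun w => b ∘ₗ (TensorProduct.mk R E F).flip w) hsep ht
    obtain ⟨z, hz⟩ := hψ' _ hw
    refine ⟨w ⊗ₜ z, ?_⟩
    rw [contract_eq_sum e] at hz
    simpa [comult_apply, TensorProduct.sum_tmul, ← TensorProduct.smul_tmul'] using hz

lemma exists_finBasis_succ [Nontrivial R] [Module.Free R E] [Module.Finite R E] :
    Subsingleton E ∨ ∃ n, Nonempty (Module.Basis (Fin (n + 1)) R E) := by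
  let e := Module.finBasis R E
  rcases h : Module.finrank R E with _ | n
  · exact Or.inl (e.reindex (finCongr h)).equivFun.subsingleton
  · exact Or.inr ⟨n, ⟨e.reindex (finCongr h)⟩⟩

/-- A realization of a free module with a pairing that is nondegenerate on the left is
dualizable. -/
lemma isDualizable_of_pairing [IsDedekindDomain R] [Module.Free R E] {V : Realization T E}
    {W : Realization T F} {b : E ⊗[R] F →ₗ[R] R}
    (hb : Realizable (V.tensor W) (Realization.unit T) b)
    (hsep : ∀ v, (∀ w, b (v ⊗ₜ w) = 0) → v = 0) : IsDualizable V := by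
  have := V.finite
  rcases exists_finBasis_succ (R := R) (E := E) with h | ⟨n, ⟨e⟩⟩
  · exact isDualizable_of_subsingleton V
  obtain ⟨X, hX₀, hX⟩ := exists_exteriorPower_realization V e
  obtain ⟨θ⟩ := exists_equiv_exteriorPower_top e
  refine isDualizable_of_isInvertible_top V e (hX n).1 (hX n).2 θ ?_
  obtain ⟨M, _, _, Z, ψ, hψ, hψ'⟩ :=
    exists_pairing_exteriorPower hb hsep e hX₀ (fun k => (hX k).2) (n + 1)
  refine isInvertible_of_pairing (Z := Z) (φ := ψ ∘ₗ TensorProduct.mk R _ M (θ.symm 1)) ?_ ?_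
  · convert hψ.comp ((realizable_congr_symm (X (n + 1)) θ).rTensor Z) using 1
    ext
    simp
  · obtain ⟨z, hz⟩ := hψ' (θ.symm 1) (by simp)
    exact fun h => hz (LinearMap.congr_fun h z)

/-- Wedge the copairing with the one already found in degree `k`. Contracting against products of
linear forms yields all products `v ∧ y`, and these span `⋀ᵏ⁺¹`. -/
lemma exists_isPoint_exteriorPower {V : Realization T E} {W : Realization T F} {c : E ⊗[R] F}
    (hc : IsPoint (V.tensor W) c)
    (hgen : ∀ v, ∃ φ : F →ₗ[R] R, TensorProduct.rid R E (φ.lTensor E c) = v)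
    {X : ∀ k, Realization T (⋀[R]^k E)} (hX₀ : IsConst (X 0))
    (hX : ∀ k, Realizable (V.tensor (X k)) (X (k + 1)) (wedge R E k)) (k : ℕ) :
    ∃ (M : Type u) (_ : AddCommGroup M) (_ : Module R M) (Z : Realization T M)
      (z : ⋀[R]^k E ⊗[R] M), IsPoint ((X k).tensor Z) z ∧
        ∀ x, ∃ φ : M →ₗ[R] R, TensorProduct.rid R _ (φ.lTensor _ z) = x := by
  induction k with
  | zero =>
    refine ⟨R, inferInstance, inferInstance, Realization.unit T,
      (exteriorPower.zeroEquiv R E).symm 1 ⊗ₜ 1, (hX₀.tensor (isConst_unit T)) _, fun x =>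
        ⟨LinearMap.toSpanSingleton R R (exteriorPower.zeroEquiv R E x), ?_⟩⟩
    simp only [LinearMap.lTensor_tmul, LinearMap.toSpanSingleton_apply_one,
      TensorProduct.rid_tmul]
    rw [← map_smul, smul_eq_mul, mul_one, LinearEquiv.symm_apply_apply]
  | succ k ih =>
    obtain ⟨M, _, _, Z, z, hz, hz'⟩ := ih
    refine ⟨F ⊗[R] M, inferInstance, inferInstance, W.tensor Z, _,
      (hc.tmul hz).map (((hX k).rTensor (W.tensor Z)).comp
        (realizable_tensorTensorTensorComm V W (X k) Z)), fun x => ?_⟩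
    obtain ⟨x, rfl⟩ := wedge_surjective k x
    induction x with
    | zero => exact ⟨0, by simp⟩
    | add x y hx hy =>
      obtain ⟨φ, hφ⟩ := hx
      obtain ⟨ψ, hψ⟩ := hy
      exact ⟨φ + ψ, by rw [LinearMap.lTensor_add, LinearMap.add_apply, map_add, hφ, hψ, map_add]⟩
    | tmul v y =>
      obtain ⟨φ, rfl⟩ := hgen v
      obtain ⟨ψ, rfl⟩ := hz' y
      refine ⟨(TensorProduct.lid R R).toLinearMap ∘ₗ TensorProduct.map φ ψ, ?_⟩
      clear hc hgen hz hz'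
      induction c with
      | zero => simp
      | add c c' h h' => simp only [TensorProduct.add_tmul, map_add, h, h']
      | tmul a a' =>
        induction z with
        | zero => simp
        | add c c' h h' => simp only [TensorProduct.tmul_add, map_add, h, h']
        | tmul b b' =>
          simp [← TensorProduct.smul_tmul', smul_smul, mul_comm]

/-- A realization of a free module with a nondegenerate copairing is dualizable. -/
lemma isDualizable_of_copairing [IsDomain R] [Module.Free R E] {V : Realization T E}
    {W : Realization T F} {c : E ⊗[R] F} (hc : IsPoint (V.tensor W) c)
    (hgen : ∀ v, ∃ φ : F →ₗ[R] R, TensorProduct.rid R E (φ.lTensor E c) = v) :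
    IsDualizable V := by
  have := V.finite
  rcases exists_finBasis_succ (R := R) (E := E) with h | ⟨n, ⟨e⟩⟩
  · exact isDualizable_of_subsingleton V
  obtain ⟨X, hX₀, hX⟩ := exists_exteriorPower_realization V e
  obtain ⟨θ⟩ := exists_equiv_exteriorPower_top e
  refine isDualizable_of_isInvertible_top V e (hX n).1 (hX n).2 θ ?_
  obtain ⟨M, _, _, Z, z, hz, hz'⟩ :=
    exists_isPoint_exteriorPower hc hgen hX₀ (fun k => (hX k).1) (n + 1)
  -- The form `χ` contracting the copairing to the generator of the top power provides
  -- unimodularity.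
  obtain ⟨χ, hχ⟩ := hz' (θ.symm 1)
  have hpt := hz.map ((realizable_congr (X (n + 1)) θ).rTensor Z)
  obtain ⟨m, hm⟩ : ∃ m : M, (θ.toLinearMap).rTensor M z = 1 ⊗ₜ m :=
    ⟨TensorProduct.lid R M (θ.toLinearMap.rTensor M z), by
      rw [← TensorProduct.lid_symm_apply, LinearEquiv.symm_apply_apply]⟩
  rw [hm] at hpt
  refine isInvertible_of_isPoint hpt χ ?_
  have h₁ : TensorProduct.rid R R (χ.lTensor R (θ.toLinearMap.rTensor M z)) =
      θ (TensorProduct.rid R _ (χ.lTensor _ z)) := by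
    clear hm hχ hz hz'
    induction z with
    | zero => simp
    | add c c' h h' => simp only [map_add, h, h']
    | tmul b b' => simp
  rw [hm, hχ] at h₁
  simpa using h₁

end ExteriorRealization

lemma exists_free_prod {R : Type u} [CommRing R] (M : Type u) [AddCommGroup M] [Module R M]
    [Module.Finite R M] [Module.Projective R M] :
    ∃ (Q : Type u) (_ : AddCommGroup Q) (_ : Module R Q), Module.Finite R Q ∧
      Module.Projective R Q ∧ Module.Free R (M × Q) := by
  obtain ⟨n, f, s, -, -, hs⟩ := Module.Finite.exists_comp_eq_id_of_projective R M
  have hfs (x : M) : f (s x) = x := LinearMap.congr_fun hs x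
  let p : (Fin n → R) →ₗ[R] LinearMap.ker f :=
    LinearMap.codRestrict _ (LinearMap.id - s ∘ₗ f) fun x => by simp [hfs]
  have hp (x : LinearMap.ker f) : p x = x := by
    ext1
    simp [p]
  refine ⟨LinearMap.ker f, inferInstance, inferInstance,
    Module.Finite.of_surjective p fun x => ⟨x, hp x⟩,
    Module.Projective.of_split (LinearMap.ker f).subtype p (LinearMap.ext hp),
    Module.Free.of_equiv (LinearEquiv.ofLinearMap (f.prod p)
      (s.coprod (LinearMap.ker f).subtype) ?_ ?_)⟩
  · refine LinearMap.ext fun ⟨x, y⟩ => Prod.ext ?_ (Subtype.ext ?_)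
    · simp [hfs]
    · simp [p, hfs]
  · ext x
    simp [p]

/-- Over a Dedekind domain torsion-free modules are flat, and finitely presented flat modules are
projective. -/
lemma projective_of_injective {R : Type u} [CommRing R] [IsDedekindDomain R] {M N : Type u}
    [AddCommGroup M] [Module R M] [AddCommGroup N] [Module R N] [Module.Finite R M]
    [Module.Projective R N] (i : M →ₗ[R] N) (hi : Function.Injective i) :
    Module.Projective R M := by
  have : Module.IsTorsionFree R N := inferInstance
  have : Module.IsTorsionFree R M := hi.moduleIsTorsionFree i (fun _ _ => map_smul i _ _)
  have := Module.finitePresentation_of_finite R M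
  exact Module.Flat.projective_of_finitePresentation

/-! ### Subobjects and quotients of dualizable objects -/

section Closure

variable {R : Type u} [CommRing R] {C : Type u₁} [Category.{v₁} C] [Abelian C] [Linear R C]
  [MonoidalCategory C] [SymmetricCategory C] {T : C ⥤ FGModuleCat.{u} R} [T.Braided] [T.Additive]
  [T.Linear R] [T.Faithful] [PreservesFiniteLimits T] [PreservesFiniteColimits T]
  {M N : Type u} [AddCommGroup M] [Module R M] [AddCommGroup N] [Module R N]
  {A : Realization T M} {B : Realization T N}

/-- Subobjects of dualizable objects are dualizable. -/
lemma IsDualizable.of_injective [IsDedekindDomain R] (hB : IsDualizable B) {i : M →ₗ[R] N}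
    (hi : Realizable A B i) (hinj : Function.Injective i) : IsDualizable A := by
  have := A.finite
  have := hB.projective
  have := projective_of_injective i hinj
  -- Adding a constant complement makes the module free, as the exterior power argument requires; it
  -- is removed at the end by passing to a retract.
  obtain ⟨Q, _, _, _, _, _⟩ := exists_free_prod (R := R) M
  obtain ⟨D, hD⟩ := exists_isConst T Q
  obtain ⟨N', _, _, B', b, ι, _, m, n, h⟩ := hB.prod hD.isDualizable
  have hj : Realizable (A.prod D) (B.prod D) (i.prodMap LinearMap.id) :=
    (hi.comp (realizable_fst A D)).prod (realizable_snd A D)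
  refine IsDualizable.of_retract (isDualizable_of_pairing (h.realizable.comp (hj.rTensor B'))
    fun v hv => ?_) (realizable_inl A D) (realizable_fst A D) fun x => rfl
  have hv' : i.prodMap LinearMap.id v = 0 := by
    rw [← h.left (i.prodMap LinearMap.id v)]
    exact Finset.sum_eq_zero fun j _ => by
      rw [show b (i.prodMap LinearMap.id v ⊗ₜ[R] n j) = 0 from hv (n j), zero_smul]
  obtain ⟨x, y⟩ := v
  simp only [LinearMap.prodMap_apply, LinearMap.id_apply, Prod.mk_eq_zero] at hv'
  rw [hv'.2, (map_eq_zero_iff i hinj).1 hv'.1, Prod.mk_zero_zero]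

/-- Quotients of dualizable objects with projective realization are dualizable. -/
lemma IsDualizable.of_surjective [IsDomain R] [Module.Projective R M] (hB : IsDualizable B)
    {p : N →ₗ[R] M} (hp : Realizable B A p) (hsurj : Function.Surjective p) :
    IsDualizable A := by
  have := A.finite
  obtain ⟨Q, _, _, _, _, _⟩ := exists_free_prod (R := R) M
  obtain ⟨D, hD⟩ := exists_isConst T Q
  obtain ⟨N', _, _, B', b, ι, _, m, n, h⟩ := hB.prod hD.isDualizable
  have hj : Realizable (B.prod D) (A.prod D) (p.prodMap LinearMap.id) :=
    (hp.comp (realizable_fst B D)).prod (realizable_snd B D)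
  -- The coevaluation of `B ⊕ D` is pushed forward to a copairing. Contracting it with the form `b
  -- (s v ⊗ ·)` returns the image of `s v`, which is `v`.
  obtain ⟨s, hs⟩ := Module.projective_lifting_property (p.prodMap (LinearMap.id (M := Q)))
    LinearMap.id (Function.Surjective.prodMap hsurj Function.surjective_id)
  refine IsDualizable.of_retract (isDualizable_of_copairing (h.isPoint.map (hj.rTensor B'))
    fun v => ⟨b ∘ₗ TensorProduct.mk R _ _ (s v), ?_⟩) (realizable_inl A D) (realizable_fst A D)
    fun x => rfl
  have := congrArg (p.prodMap LinearMap.id) (h.left (s v))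
  rw [← LinearMap.comp_apply _ s, hs] at this
  simpa using this

variable (T) in
/-- The objects that are quotients of dualizable objects. -/
def quotientsOfDualizable : ObjectProperty C := fun X =>
  ∃ (Y : C) (p : Y ⟶ X), Epi p ∧ IsDualizable (Realization.of T Y)

instance : (quotientsOfDualizable T).IsClosedUnderQuotients where
  prop_of_epi f _ := by
    rintro ⟨Y, p, _, hY⟩
    exact ⟨Y, p ≫ f, inferInstance, hY⟩

lemma prop_of_isDualizable {X : C} (h : IsDualizable (Realization.of T X)) :
    quotientsOfDualizable T X := ⟨X, 𝟙 X, inferInstance, h⟩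

instance : (quotientsOfDualizable T).IsClosedUnderBinaryProducts where
  limitsOfShape_le := by
    rintro X ⟨p⟩
    obtain ⟨Y, f, _, hY⟩ := p.prop_diag_obj (.mk .left)
    obtain ⟨Z, g, _, hZ⟩ := p.prop_diag_obj (.mk .right)
    have i := IsLimit.conePointUniqueUpToIso (BinaryBiproduct.isLimit _ _)
      ((IsLimit.postcomposeHomEquiv (diagramIsoPair p.diag) _).2 p.isLimit)
    have : Epi (biprod.map f g) := ⟨fun a b h => by
      ext
      · rw [← cancel_epi f, ← biprod.inl_map_assoc, h, biprod.inl_map_assoc]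
      · rw [← cancel_epi g, ← biprod.inr_map_assoc, h, biprod.inr_map_assoc]⟩
    exact (quotientsOfDualizable T).prop_of_iso i
      ⟨Y ⊞ Z, biprod.map f g, this, (hY.prod hZ).of_tautological⟩

-- Only kernels are delicate. If `p : Y ⟶ X` is epi, then the kernel of `p ≫ f` surjects onto the
-- kernel of `f`, and it is dualizable as a subobject of `Y`.
open ZeroObject in
lemma isAbelianTensorSubcategory_quotientsOfDualizable [IsDedekindDomain R] :
    IsAbelianTensorSubcategory (quotientsOfDualizable T) where
  finiteProducts := by
    have : (quotientsOfDualizable T).ContainsZero := ⟨(0 : C), isZero_zero C, by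
      obtain ⟨A, hA⟩ := exists_isConst T (PUnit : Type u)
      exact (quotientsOfDualizable T).prop_of_epi (0 : A.obj ⟶ 0)
        (prop_of_isDualizable hA.isDualizable.of_tautological)⟩
    exact .mk'
  kernels := by
    refine ⟨?_⟩
    rintro _ ⟨f, k, hk, ⟨Y, p, _, hY⟩, -⟩
    let l : kernel (p ≫ f) ⟶ k.pt := hk.lift (KernelFork.ofι (kernel.ι (p ≫ f) ≫ p) (by simp))
    have hl : l ≫ k.ι = kernel.ι (p ≫ f) ≫ p := hk.fac _ WalkingParallelPair.zero
    have : Mono k.ι := ⟨fun a b h => Fork.IsLimit.hom_ext hk h⟩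
    refine ⟨kernel (p ≫ f), l, epi_of_mapLin_surjective T _ fun x => ?_,
      hY.of_injective (realizable_mapLin T (kernel.ι (p ≫ f)))
        (mapLin_injective_of_mono T _)⟩
    obtain ⟨y, hy⟩ := mapLin_surjective_of_epi T p (mapLin T k.ι x)
    have hy' : y ∈ LinearMap.ker (mapLin T (p ≫ f)) := by
      rw [LinearMap.mem_ker, mapLin_comp_apply, hy, ← mapLin_comp_apply, k.condition]
      simp
    rw [← range_mapLin_kernel_ι] at hy'
    obtain ⟨z, rfl⟩ := hy'
    refine ⟨z, mapLin_injective_of_mono T k.ι ?_⟩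
    rw [← mapLin_comp_apply, hl, mapLin_comp_apply, hy]
  cokernels := inferInstance
  monoidal :=
    { prop_unit := prop_of_isDualizable (isDualizable_unit T).of_tautological
      prop_tensor := by
        rintro X X' ⟨Y, p, _, hY⟩ ⟨Y', p', _, hY'⟩
        refine ⟨Y ⊗ Y', p ⊗ₘ p', ?_, (hY.tensor hY').of_tautological⟩
        have h : Lifts (.of T Y) (.of T X) p (mapLin T p) := fun _ => rfl
        have h' : Lifts (.of T Y') (.of T X') p' (mapLin T p') := fun _ => rfl
        exact epi_of_mapLin_surjective T _ ((h.tensorHom h').surjective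
          (TensorProduct.map_surjective (mapLin_surjective_of_epi T p)
            (mapLin_surjective_of_epi T p'))) }

lemma isDualizable_of_isPerfPair [IsDedekindDomain R] {V W : C} [Module.Free R (T.obj V)]
    (q : V ⊗ W ⟶ 𝟙_ C) (hq : (pairing T q).IsPerfPair) : IsDualizable (Realization.of T V) := by
  refine isDualizable_of_pairing (W := .of T W)
    (b := etaLin T ∘ₗ mapLin T q ∘ₗ muLin T V W) ⟨q, lifts_of_tmul fun _ _ => rfl⟩ fun v hv => ?_
  refine (map_eq_zero_iff _ hq.bijective_left.1).1 (LinearMap.ext fun w => hv w)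

/-- Perfectness represents evaluation at `v` by some `ψ`. Contracting the copairing with `ψ` then
gives `v`, since linear forms separate points of a free module. -/
lemma isDualizable_of_dualPairing_isPerfPair [IsDomain R] {V W : C} [Module.Free R (T.obj V)]
    (q : 𝟙_ C ⟶ V ⊗ W) (hq : (dualPairing T q).IsPerfPair) :
    IsDualizable (Realization.of T V) := by
  refine isDualizable_of_copairing (W := .of T W) (c := copairingElement T q) ⟨q, ?_⟩ fun v => ?_
  · rw [lifts_iff_symm]
    intro r
    change TensorProduct.congr (.refl R _) (.refl R _) (deltaLin T V W (mapLin T q (epsLin T r))) =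
      r • copairingElement T q
    rw [TensorProduct.congr_refl_refl, copairingElement, ← map_smul, ← map_smul, ← map_smul,
      smul_eq_mul, mul_one, LinearEquiv.refl_apply]
  · obtain ⟨ψ, hψ⟩ := hq.bijective_right.2 (Module.Dual.eval R _ v)
    refine ⟨ψ, ?_⟩
    rw [← sub_eq_zero, ← Module.forall_dual_apply_eq_zero_iff R]
    intro φ
    rw [map_sub, sub_eq_zero]
    refine Eq.trans ?_ (LinearMap.congr_fun hψ φ)
    change _ = TensorProduct.dualDistrib R _ _ (φ ⊗ₜ ψ) (copairingElement T q)
    generalize copairingElement T q = c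
    induction c with
    | zero => simp
    | add x y hx hy => simp only [map_add, hx, hy]
    | tmul x y => simp [mul_comm]

end Closure

/-! ### Invertibility of tensor endomorphisms -/

section Tannakian

variable {R : Type u} [CommRing R] {C : Type u₁} [Category.{v₁} C] [MonoidalCategory C]
  {T : C ⥤ FGModuleCat.{u} R}

lemma muBaseChange_injective [T.Monoidal] (S : Type w) [CommRing S] [Algebra R S] (X Y : C) :
    Function.Injective (muBaseChange T S X Y) := by
  have h : Function.Injective ((muLin T X Y).baseChange S) :=
    ((deltaEquiv T X Y).symm.baseChange R S _ _).injective
  exact h.comp (LinearEquiv.injective _)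

lemma isUnit_of_bijective [T.Monoidal] {S : Type w} [CommRing S] [Algebra R S]
    (g : TannakianDual T S) (hg : ∀ X, Function.Bijective (g.app X)) : IsUnit g := by
  let e (X : C) := LinearEquiv.ofBijective (g.app X) (hg X)
  have he (X : C) (t) : g.app X ((e X).symm t) = t := (e X).apply_symm_apply t
  have he' (X : C) (t) : (e X).symm (g.app X t) = t := (e X).symm_apply_apply t
  let h : TannakianDual T S :=
    { app := fun X => (e X).symm.toLinearMap
      naturality := fun {X Y} f => LinearMap.ext fun t => (hg Y).1 <| by
        have := LinearMap.congr_fun (g.naturality f) ((e X).symm t)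
        simp only [LinearMap.comp_apply, LinearEquiv.coe_coe, he] at this ⊢
        exact this.symm
      tensor := fun X Y => LinearMap.ext fun t => (hg _).1 <| by
        have h₁ := LinearMap.congr_fun (g.tensor X Y)
          (TensorProduct.map (e X).symm.toLinearMap (e Y).symm.toLinearMap t)
        have h₂ : TensorProduct.map (g.app X) (g.app Y)
            (TensorProduct.map (e X).symm.toLinearMap (e Y).symm.toLinearMap t) = t := by
          rw [← LinearMap.comp_apply, ← TensorProduct.map_comp,
            show g.app X ∘ₗ (e X).symm.toLinearMap = LinearMap.id from LinearMap.ext (he X),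
            show g.app Y ∘ₗ (e Y).symm.toLinearMap = LinearMap.id from LinearMap.ext (he Y),
            TensorProduct.map_id, LinearMap.id_apply]
        simp only [LinearMap.comp_apply, LinearEquiv.coe_coe, he] at h₁ ⊢
        rw [h₁, h₂]
      unit := LinearMap.ext fun t => (hg _).1 <| by
        have := LinearMap.congr_fun g.unit t
        simp only [LinearMap.comp_apply, LinearEquiv.coe_coe, he] at this ⊢
        exact this.symm }
  exact ⟨⟨g, h, TannakianDual.ext (funext fun X => LinearMap.ext (he X)),
    TannakianDual.ext (funext fun X => LinearMap.ext (he' X))⟩, rfl⟩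

variable [Abelian C] [Linear R C]
  [SymmetricCategory C] [T.Braided] [T.Additive]
  [T.Linear R] [T.Faithful] [PreservesFiniteLimits T] [PreservesFiniteColimits T]

/-- The coevaluation comes from the unit, so `g` fixes it: `∑ g mᵢ ⊗ g nᵢ = ∑ mᵢ ⊗ nᵢ`. Contracting
the second factor with `b (x ⊗ ·)` gives `x` on the right and a combination of the `g mᵢ` on the
left. -/
lemma app_surjective_of_isDualizable {S : Type w} [CommRing S] [Algebra R S]
    (g : TannakianDual T S) {X : C} (h : IsDualizable (Realization.of T X)) :
    Function.Surjective (g.app X) := by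
  obtain ⟨N, _, _, B, b, ι, _, m, n, h⟩ := h
  obtain ⟨q, hq⟩ := h.isPoint
  have hq₁ : mapLin T q (epsLin T 1) =
      muLin T X B.obj (∑ i, m i ⊗ₜ B.equiv.symm (n i)) := by
    have := hq.symm_apply 1
    rw [LinearMap.toSpanSingleton_apply_one, map_sum] at this
    rw [map_sum]
    exact this
  have hq₂ : (1 : S) ⊗ₜ[R] mapLin T q (epsLin T 1) =
      muBaseChange T S X B.obj (∑ i, ((1 : S) ⊗ₜ[R] m i) ⊗ₜ[S] (1 ⊗ₜ[R] B.equiv.symm (n i))) := by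
    rw [hq₁]
    simp [muBaseChange, TensorProduct.tmul_sum]
  have hg : g.app (X ⊗ B.obj) ((1 : S) ⊗ₜ[R] mapLin T q (epsLin T 1)) =
      (1 : S) ⊗ₜ[R] mapLin T q (epsLin T 1) := by
    have h₁ := LinearMap.congr_fun (g.naturality q) ((epsLin T).baseChange S (1 ⊗ₜ 1))
    have h₂ := LinearMap.congr_fun g.unit (1 ⊗ₜ 1)
    rw [LinearMap.comp_apply, LinearMap.comp_apply] at h₁
    rw [LinearMap.comp_apply] at h₂
    rw [h₂] at h₁
    simpa using! h₁
  have hinv : ∑ i, g.app X ((1 : S) ⊗ₜ[R] m i) ⊗ₜ[S] g.app B.obj (1 ⊗ₜ[R] B.equiv.symm (n i)) =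
      ∑ i, ((1 : S) ⊗ₜ[R] m i) ⊗ₜ[S] (1 ⊗ₜ[R] B.equiv.symm (n i)) := by
    apply muBaseChange_injective S X B.obj
    rw [← hq₂, ← hg, hq₂, ← LinearMap.comp_apply, g.tensor, LinearMap.comp_apply]
    simp
  suffices ∀ x : T.obj X, (1 : S) ⊗ₜ[R] x ∈ LinearMap.range (g.app X) by
    intro t
    rw [← LinearMap.mem_range]
    induction t with
    | zero => exact zero_mem _
    | add x y hx hy => exact add_mem hx hy
    | tmul s x =>
      have := Submodule.smul_mem _ s (this x)
      rwa [TensorProduct.smul_tmul', smul_eq_mul, mul_one] at this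
  intro x
  let β : S ⊗[R] T.obj B.obj →ₗ[S] S := (TensorProduct.AlgebraTensorModule.rid R S S).toLinearMap ∘ₗ
    (b ∘ₗ TensorProduct.mk R _ N x ∘ₗ B.equiv.toLinearMap).baseChange S
  have := congrArg (TensorProduct.rid S _ ∘ β.lTensor _) hinv
  simp only [Function.comp_apply, map_sum, LinearMap.lTensor_tmul, TensorProduct.rid_tmul] at this
  have hx : ∑ i, β (1 ⊗ₜ[R] B.equiv.symm (n i)) • ((1 : S) ⊗ₜ[R] m i) = 1 ⊗ₜ[R] x := by
    conv_rhs => rw [← h.left x, TensorProduct.tmul_sum]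
    refine Finset.sum_congr rfl fun i _ => ?_
    simp [β]
  rw [hx] at this
  rw [← this]
  exact Submodule.sum_mem _ fun i _ => Submodule.smul_mem _ _ ⟨_, rfl⟩

lemma app_bijective {S : Type w} [CommRing S] [Algebra R S] (g : TannakianDual T S) {X : C}
    (h : quotientsOfDualizable T X) : Function.Bijective (g.app X) := by
  obtain ⟨Y, p, _, hY⟩ := h
  have hs : Function.Surjective (g.app X) := by
    refine Function.Surjective.of_comp (g := (mapLin T p).baseChange S) ?_
    rw [← LinearMap.coe_comp, g.naturality, LinearMap.coe_comp]
    exact (LinearMap.lTensor_surjective S (mapLin_surjective_of_epi T p)).comp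
      (app_surjective_of_isDualizable g hY)
  -- A surjective endomorphism of the finitely generated module `S ⊗ T X` is injective.
  exact ⟨OrzechProperty.injective_of_surjective_endomorphism _ hs, hs⟩

end Tannakian

end NoriRigidity

end

/-! ### The theorem; `IsDedekindDomain` allows fields, so both cases are treated at once -/

theorem propositionC3 {R : Type u} [CommRing R] [IsDedekindDomain R]
    {C : Type u₁} [Category.{v₁} C] [Abelian C] [Linear R C]
    [MonoidalCategory C] [SymmetricCategory C] [MonoidalPreadditive C] [MonoidalLinear R C]
    (T : C ⥤ FGModuleCat.{u} R) [T.Braided] [T.Additive] [T.Linear R] [T.Faithful]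
    [PreservesFiniteLimits T] [PreservesFiniteColimits T]
    {I : Type*} (V : I → C) (hgen : GeneratesAsAbelianTensor V)
    (hdual : ∀ i, ∃ W : C, Module.Free R (T.obj (V i)) ∧ Module.Free R (T.obj W) ∧
      ((∃ q : V i ⊗ W ⟶ 𝟙_ C, (pairing T q).IsPerfPair) ∨
        (∃ q : 𝟙_ C ⟶ V i ⊗ W, (dualPairing T q).IsPerfPair))) :
    (IsField R → ∀ X : C, ∃ X' : C, IsDual X X') ∧
    (∀ X : C, Module.Projective R (T.obj X) → ∃ X' : C, IsDual X X') ∧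
    (∀ X : C, ∃ (Y : C) (p : Y ⟶ X), Epi p ∧ Module.Projective R (T.obj Y)) ∧
    (∀ (S : Type w) [CommRing S] [Algebra R S] (g : TannakianDual T S), IsUnit g) := by
  have hall (X : C) : quotientsOfDualizable T X := by
    refine hgen _ isAbelianTensorSubcategory_quotientsOfDualizable (fun i => ?_) X
    obtain ⟨W, _, -, ⟨q, hq⟩ | ⟨q, hq⟩⟩ := hdual i
    · exact prop_of_isDualizable (isDualizable_of_isPerfPair q hq)
    · exact prop_of_isDualizable (isDualizable_of_dualPairing_isPerfPair q hq)
  have hproj (X : C) (_ : Module.Projective R (T.obj X)) : ∃ X' : C, IsDual X X' := by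
    obtain ⟨Y, p, _, hY⟩ := hall X
    exact (hY.of_surjective (A := .of T X) (realizable_mapLin T p)
      (mapLin_surjective_of_epi T p)).exists_isDual
  refine ⟨fun hR X => hproj X ?_, hproj, fun X => ?_, fun S _ _ g =>
    isUnit_of_bijective g fun X => app_bijective g (hall X)⟩
  · let := hR.toField
    exact Module.Projective.of_free
  · obtain ⟨Y, p, hp, hY⟩ := hall X
    exact ⟨Y, p, hp, hY.projective⟩
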